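/- **Conventions.** Structural isomorphisms of bicategories and pseudofunctors are left implicit in composites of 2-cells, and $\circ$ is composition of 1-cells. A *binoidal bicategory* is a bicategory $\mathcal B$ with pseudofunctors $A\rtimes(-)$ and $(-)\ltimes B:\mathcal B\to\mathcal B$ for all objects $A,B$, such that $A\rtimes B=A\ltimes B$ on objects; the common value is written $AB$. A *central 1-cell* is a 1-cell $f:A\to A'$ with invertible 2-cells $$\mathsf{lc}^f_g:(f\ltimes B')\circ(A\rtimes g)\Rightarrow(A'\rtimes g)\circ(f\ltimes B),\qquad \mathsf{rc}^f_g:(B'\rtimes f)\circ(g\ltimes A)\Rightarrow(g\ltimes A')\circ(B\rtimes f)$$ for every $g:B\to B'$, making the families $f\ltimes B$ and $B\rtimes f$ into pseudonatural transformations $\mathsf{lc}^f:A\rtimes(-)\Rightarrow A'\rtimes(-)$ and $\mathsf{rc}^f:(-)\ltimes A\Rightarrow(-)\ltimes A'$. A *central 2-cell* $(f,\mathsf{lc}^f,\mathsf{rc}^f)\Rightarrow(f',\mathsf{lc}^{f'},\mathsf{rc}^{f'})$ is a 2-cell $\sigma:f\Rightarrow f'$ such that the 2-cells $\sigma\ltimes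 B$ and $B\rtimes\sigma$ form modifications $\mathsf{lc}^f\Rightarrow\mathsf{lc}^{f'}$ and $\mathsf{rc}^f\Rightarrow\mathsf{rc}^{f'}$. The *centre* $\mathcal Z(\mathcal B)$ is the bicategory with the objects of $\mathcal B$, the central 1-cells and the central 2-cells; the transformations $\mathsf{lc},\mathsf{rc}$ of identities and composites are the identity transformations and the vertical composites, transported along the unitors and compositors of $(-)\ltimes B$ and $B\rtimes(-)$. There is an evident forgetful pseudofunctor $U:\mathcal Z(\mathcal B)\to\mathcal B$. A *premonoidal bicategory* is a binoidal bicategory with: - adjoint equivalences $\alpha_{A,B,C}:(AB)C\to A(BC)$, each with chosen $\mathsf{lc},\mathsf{rc}$ making it central, and invertible 2-cells making them pseudonatural in each argument separately: $((-)\ltimes B)\ltimes C\Rightarrow(-)\ltimes(BC)$, $(A\rtimes(-))\ltimes C\Rightarrow A\rtimes((-)\ltimes C)$ and $(AB)\rtimes(-)\Rightarrow A\rtimes(B\rtimes(-))$; - an object $I$ and pseudonatural transformations $\lambda:I\rtimes(-)\Rightarrow\mathrm{Id}$ and $\rho:(-)\ltimes I\Rightarrow\mathrm{Id}$ whose components are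 adjoint equivalences with chosen $\mathsf{lc},\mathsf{rc}$ making them central; - invertible 2-cells $$\begin{aligned}\mathfrak p_{A,B,C,D}&:(A\rtimes\alpha_{B,C,D})\circ\alpha_{A,BC,D}\circ(\alpha_{A,B,C}\ltimes D)\Rightarrow\alpha_{A,B,CD}\circ\alpha_{AB,C,D},\\ \mathfrak m_{A,B}&:(A\rtimes\lambda_B)\circ\alpha_{A,I,B}\Rightarrow\rho_A\ltimes B,\\ \mathfrak l_{A,B}&:\lambda_A\ltimes B\Rightarrow\lambda_{AB}\circ\alpha_{I,A,B},\\ \mathfrak r_{A,B}&:\rho_{AB}\Rightarrow(A\rtimes\rho_B)\circ\alpha_{A,B,I},\end{aligned}$$ which are modifications in each argument, where the naturality 2-cells of $\alpha_{A,B,C}\ltimes(-)$, $\rho_A\ltimes(-)$, $\lambda_A\ltimes(-)$ are $\mathsf{lc}^{\alpha},\mathsf{lc}^{\rho},\mathsf{lc}^{\lambda}$ and those of $(-)\rtimes\alpha_{B,C,D}$, $(-)\rtimes\lambda_B$, $(-)\rtimes\rho_B$ are $\mathsf{rc}^{\alpha},\mathsf{rc}^{\lambda},\mathsf{rc}^{\rho}$;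 which are central 2-cells, for the induced centrality (defined below) of the 1-cells $\alpha\ltimes D$, $A\rtimes\alpha$, $\rho\ltimes B$, $\lambda\ltimes B$, $A\rtimes\lambda$, $A\rtimes\rho$; and which satisfy the three coherence equations of a monoidal bicategory: the associahedron equation for $(((AB)C)D)E$ and the unit equations for $((AI)B)C$ and $((AB)I)C$. *Induced centrality.* Let $X$ be an object and $(f,\mathsf{lc}^f,\mathsf{rc}^f):A\to A'$ a central 1-cell. A centrality structure on $X\rtimes f$ is *induced by* that of $f$ if, with $B$ varying, - the naturality 2-cells $\alpha_{X,A',B}\circ((X\rtimes f)\ltimes B)\Rightarrow(X\rtimes(f\ltimes B))\circ\alpha_{X,A,B}$ form a modification $\alpha_{X,A',-}\circ\mathsf{lc}^{X\rtimes f}\Rightarrow(X\rtimes\mathsf{lc}^f)\circ\alpha_{X,A,-}$, and - the naturality 2-cells $\alpha_{B,X,A'}\circ((BX)\rtimes f)\Rightarrow(B\rtimes(X\rtimes f))\circ\alpha_{B,X,A}$ form a modification $\alpha_{-,X,A'}\circ\mathsf{rc}^f_{(-)\ltimes X}\Rightarrow\mathsf{rc}^{X\rtimes f}\circ\alpha_{-,X,A}$.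 A centrality structure on $f\ltimes X$ is *induced by* that of $f$ if - the naturality 2-cells $\alpha_{A',X,B}\circ((f\ltimes X)\ltimes B)\Rightarrow(f\ltimes(XB))\circ\alpha_{A,X,B}$ form a modification $\alpha_{A',X,-}\circ\mathsf{lc}^{f\ltimes X}\Rightarrow\mathsf{lc}^f_{X\rtimes(-)}\circ\alpha_{A,X,-}$, and - the naturality 2-cells $\alpha_{B,A',X}\circ((B\rtimes f)\ltimes X)\Rightarrow(B\rtimes(f\ltimes X))\circ\alpha_{B,A,X}$ form a modification $\alpha_{-,A',X}\circ(\mathsf{rc}^f\ltimes X)\Rightarrow\mathsf{rc}^{f\ltimes X}\circ\alpha_{-,A,X}$. **Proposition.** Let $\mathcal B$ be a premonoidal bicategory. For all objects $A,B$ the pseudofunctors $A\rtimes(-)$ and $(-)\ltimes B$ lift to pseudofunctors on $\mathcal Z(\mathcal B)$, with the same action on objects, strictly along $U$ (that is, composing the lift with $U$ equals composing $U$ with the original pseudofunctor), which send a central 1-cell $f$ to $A\rtimes f$, respectively $f\ltimes B$, with centrality structure induced by that of $f$. Consequently, $\mathcal Z(\mathcal B)$ is a binoidal bicategory with the same tensor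 product on objects as $\mathcal B$. -/

import Mathlib

open CategoryTheory Bicategory

universe w v u

namespace PremonoidalBicat

universe w₁ w₂ w₃ v₁ v₂ v₃ u₁ u₂ u₃

/-! ### Pseudofunctors and pseudonatural transformations with prescribed underlying data -/

section Basic

variable {B : Type u₁} [Bicategory.{w₁, v₁} B] {C : Type u₂} [Bicategory.{w₂, v₂} C]
  {D : Type u₃} [Bicategory.{w₃, v₃} D]

/-- A pseudofunctor `B ⥤ᵖ C` whose action on objects is the given function `o`.
Fixing `o` lets two pseudofunctors share their values on objects definitionally. -/
structure PseudofunctorOn (o : B → C) where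
  map {a b : B} (f : a ⟶ b) : o a ⟶ o b
  map₂ {a b : B} {f g : a ⟶ b} (η : f ⟶ g) : map f ⟶ map g
  map₂_id {a b : B} (f : a ⟶ b) : map₂ (𝟙 f) = 𝟙 (map f)
  map₂_comp {a b : B} {f g h : a ⟶ b} (η : f ⟶ g) (θ : g ⟶ h) :
    map₂ (η ≫ θ) = map₂ η ≫ map₂ θ
  mapId (a : B) : map (𝟙 a) ≅ 𝟙 (o a)
  mapComp {a b c : B} (f : a ⟶ b) (g : b ⟶ c) : map (f ≫ g) ≅ map f ≫ map g
  map₂_whisker_left {a b c : B} (f : a ⟶ b) {g h : b ⟶ c} (η : g ⟶ h) :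
    map₂ (f ◁ η) = (mapComp f g).hom ≫ map f ◁ map₂ η ≫ (mapComp f h).inv
  map₂_whisker_right {a b c : B} {f g : a ⟶ b} (η : f ⟶ g) (h : b ⟶ c) :
    map₂ (η ▷ h) = (mapComp f h).hom ≫ map₂ η ▷ map h ≫ (mapComp g h).inv
  map₂_associator {a b c d : B} (f : a ⟶ b) (g : b ⟶ c) (h : c ⟶ d) :
    map₂ (α_ f g h).hom = (mapComp (f ≫ g) h).hom ≫ (mapComp f g).hom ▷ map h ≫
      (α_ (map f) (map g) (map h)).hom ≫ map f ◁ (mapComp g h).inv ≫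
      (mapComp f (g ≫ h)).inv
  map₂_left_unitor {a b : B} (f : a ⟶ b) :
    map₂ (λ_ f).hom = (mapComp (𝟙 a) f).hom ≫ (mapId a).hom ▷ map f ≫ (λ_ (map f)).hom
  map₂_right_unitor {a b : B} (f : a ⟶ b) :
    map₂ (ρ_ f).hom = (mapComp f (𝟙 b)).hom ≫ map f ◁ (mapId b).hom ≫ (ρ_ (map f)).hom

/-- The underlying pseudofunctor. -/
abbrev PseudofunctorOn.toPseudofunctor {o : B → C} (F : PseudofunctorOn o) : B ⥤ᵖ C where
  obj := o
  map := F.map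
  map₂ := F.map₂
  map₂_id := F.map₂_id
  map₂_comp := F.map₂_comp
  mapId := F.mapId
  mapComp := F.mapComp
  map₂_whisker_left := F.map₂_whisker_left
  map₂_whisker_right := F.map₂_whisker_right
  map₂_associator := F.map₂_associator
  map₂_left_unitor := F.map₂_left_unitor
  map₂_right_unitor := F.map₂_right_unitor

/-- A pseudonatural transformation `F ⟶ G` whose 1-cell components are the given family `app`. -/
structure StrongTransOn (F G : B ⥤ᵖ C) (app : ∀ a, F.obj a ⟶ G.obj a) where
  naturality {a b : B} (f : a ⟶ b) : F.map f ≫ app b ≅ app a ≫ G.map f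
  naturality_naturality {a b : B} {f g : a ⟶ b} (η : f ⟶ g) :
    F.map₂ η ▷ app b ≫ (naturality g).hom = (naturality f).hom ≫ app a ◁ G.map₂ η
  naturality_id (a : B) :
    (naturality (𝟙 a)).hom ≫ app a ◁ (G.mapId a).hom =
      (F.mapId a).hom ▷ app a ≫ (λ_ (app a)).hom ≫ (ρ_ (app a)).inv
  naturality_comp {a b c : B} (f : a ⟶ b) (g : b ⟶ c) :
    (naturality (f ≫ g)).hom ≫ app a ◁ (G.mapComp f g).hom =
      (F.mapComp f g).hom ▷ app c ≫ (α_ _ _ _).hom ≫ F.map f ◁ (naturality g).hom ≫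
        (α_ _ _ _).inv ≫ (naturality f).hom ▷ G.map g ≫ (α_ _ _ _).hom

open scoped Pseudofunctor.StrongTrans

/-- The underlying strong transformation. -/
abbrev StrongTransOn.toStrongTrans {F G : B ⥤ᵖ C} {app : ∀ a, F.obj a ⟶ G.obj a}
    (η : StrongTransOn F G app) : F ⟶ G where
  app := app
  naturality := η.naturality
  naturality_naturality := η.naturality_naturality
  naturality_id := η.naturality_id
  naturality_comp := η.naturality_comp

/-- Replace the components of a strong transformation by isomorphic 1-cells. -/
def StrongTransOn.ofIso {F G : B ⥤ᵖ C} (η : F ⟶ G) {app : ∀ a, F.obj a ⟶ G.obj a}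
    (e : ∀ a, app a ≅ η.app a) : StrongTransOn F G app where
  naturality {a b} f :=
    whiskerLeftIso (F.map f) (e b) ≪≫ η.naturality f ≪≫ (whiskerRightIso (e a) (G.map f)).symm
  naturality_naturality {a b f g} θ := by
    have := Pseudofunctor.StrongTrans.naturality_naturality η θ
    simp only [Iso.trans_hom, whiskerLeftIso_hom, Iso.symm_hom, whiskerRightIso_inv,
      Category.assoc]
    rw [← whisker_exchange, reassoc_of% this.symm, ← whisker_exchange_assoc]
  naturality_id a := by
    simp only [Iso.trans_hom, whiskerLeftIso_hom, Iso.symm_hom, whiskerRightIso_inv,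
      Category.assoc]
    rw [← whisker_exchange, Pseudofunctor.StrongTrans.naturality_id_assoc,
      whisker_exchange_assoc]
    simp
  naturality_comp f g := by
    simp only [Iso.trans_hom, whiskerLeftIso_hom, Iso.symm_hom, whiskerRightIso_inv,
      Category.assoc]
    rw [← whisker_exchange, Pseudofunctor.StrongTrans.naturality_comp_assoc,
      whisker_exchange_assoc]
    simp

/-- `StrongTransOn.ofIso η e` is isomorphic to `η`, with components `e`. -/
def StrongTransOn.ofIsoIso {F G : B ⥤ᵖ C} (η : F ⟶ G) {app : ∀ a, F.obj a ⟶ G.obj a}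
    (e : ∀ a, app a ≅ η.app a) :
    (StrongTransOn.ofIso η e).toStrongTrans ≅ η :=
  Pseudofunctor.StrongTrans.isoMk e (by simp [ofIso])

/-- The 1-cells and invertible 2-cells underlying a pseudonatural transformation. Whether a family
of 2-cells is a modification depends on these only. -/
structure TransData (F G : B ⥤q C) where
  app (a : B) : F.obj a ⟶ G.obj a
  nat {a b : B} (f : a ⟶ b) : F.map f ≫ app b ≅ app a ≫ G.map f

/-- The action of a pseudofunctor on objects and 1-cells. -/
abbrev under (F : B ⥤ᵖ C) : B ⥤q C := F.toPrelaxFunctor.toPrefunctor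

/-- The data underlying a pseudonatural transformation. -/
abbrev StrongTransOn.data {F G : B ⥤ᵖ C} {app : ∀ a, F.obj a ⟶ G.obj a}
    (η : StrongTransOn F G app) : TransData (under F) (under G) where
  app := app
  nat := η.naturality

namespace TransData

/-- Vertical composition. -/
def comp {F G H : B ⥤q C} (η : TransData F G) (θ : TransData G H) : TransData F H where
  app a := η.app a ≫ θ.app a
  nat {a b} f := (α_ _ _ _).symm ≪≫ whiskerRightIso (η.nat f) (θ.app b) ≪≫ α_ _ _ _ ≪≫
    whiskerLeftIso (η.app a) (θ.nat f) ≪≫ (α_ _ _ _).symm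

/-- Precomposition of a transformation `F ⟶ G` with `H`. -/
def pre (H : B ⥤q C) {F G : C ⥤q D} (η : TransData F G) : TransData (H ⋙q F) (H ⋙q G) where
  app a := η.app (H.obj a)
  nat f := η.nat (H.map f)

/-- Postcomposition of a transformation `F ⟶ G` with a pseudofunctor `K`. -/
def post {F G : B ⥤q C} (η : TransData F G) (K : C ⥤ᵖ D) :
    TransData (F ⋙q under K) (G ⋙q under K) where
  app a := K.map (η.app a)
  nat {a b} f := (K.mapComp (F.map f) (η.app b)).symm ≪≫ K.map₂Iso (η.nat f) ≪≫
    K.mapComp (η.app a) (G.map f)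

/-- The family of 2-cells `Γ` is a modification from `η` to `θ`. -/
def IsModification {F G : B ⥤q C} (η θ : TransData F G) (Γ : ∀ a, η.app a ⟶ θ.app a) : Prop :=
  ∀ {a b : B} (f : a ⟶ b),
    F.map f ◁ Γ b ≫ (θ.nat f).hom = (η.nat f).hom ≫ Γ a ▷ G.map f

end TransData

/-- The image of a composite of three 1-cells under a pseudofunctor. -/
def mapComp₃ (F : B ⥤ᵖ C) {a b c d : B} (f : a ⟶ b) (g : b ⟶ c) (h : c ⟶ d) :
    F.map (f ≫ g ≫ h) ≅ F.map f ≫ F.map g ≫ F.map h :=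
  F.mapComp f (g ≫ h) ≪≫ whiskerLeftIso (F.map f) (F.mapComp g h)

end Basic

/-! ### Binoidal bicategories and centrality -/

/-- A binoidal structure on the bicategory `B` with tensor product of objects `t`:
pseudofunctors `A ⋊ (-)` and `(-) ⋉ A` for all objects `A`, with `A ⋊ X = A ⋉ X = t A X`. -/
structure Binoidal (B : Type u) [Bicategory.{w, v} B] (t : B → B → B) where
  /-- `A ⋊ (-)` -/
  left (A : B) : PseudofunctorOn (fun X => t A X)
  /-- `(-) ⋉ A` -/
  right (A : B) : PseudofunctorOn (fun X => t X A)

section Centrality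

variable {B : Type u} [Bicategory.{w, v} B] {t : B → B → B}

/-- The pseudofunctor `A ⋊ (-)`. -/
abbrev Binoidal.L (S : Binoidal B t) (A : B) : B ⥤ᵖ B := (S.left A).toPseudofunctor

/-- The pseudofunctor `(-) ⋉ A`. -/
abbrev Binoidal.R (S : Binoidal B t) (A : B) : B ⥤ᵖ B := (S.right A).toPseudofunctor

/-- The structure of a central 1-cell on `f : A ⟶ A'`. -/
structure CentralStr (S : Binoidal B t) {A A' : B} (f : A ⟶ A') where
  /-- `A ⋊ (-) ⟶ A' ⋊ (-)` with components `f ⋉ X` -/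
  lc : StrongTransOn (S.L A) (S.L A') (fun X => (S.R X).map f)
  /-- `(-) ⋉ A ⟶ (-) ⋉ A'` with components `X ⋊ f` -/
  rc : StrongTransOn (S.R A) (S.R A') (fun X => (S.L X).map f)

variable {S : Binoidal B t}

/-- A 2-cell between central 1-cells is central. -/
structure IsCentral₂ {A A' : B} {f g : A ⟶ A'} (c : CentralStr S f) (d : CentralStr S g)
    (σ : f ⟶ g) : Prop where
  lc : TransData.IsModification c.lc.data d.lc.data (fun X => (S.R X).map₂ σ)
  rc : TransData.IsModification c.rc.data d.rc.data (fun X => (S.L X).map₂ σ)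

open scoped Pseudofunctor.StrongTrans

/-- The identity transformations make `𝟙 A` central, after identifying `𝟙 A ⋉ X` and `X ⋊ 𝟙 A`
with identities. -/
def CentralStr.id (S : Binoidal B t) (A : B) : CentralStr S (𝟙 A) where
  lc := StrongTransOn.ofIso (𝟙 (S.L A)) (fun X => (S.R X).mapId A)
  rc := StrongTransOn.ofIso (𝟙 (S.R A)) (fun X => (S.L X).mapId A)

/-- Composition of the transformations, after identifying `(f ≫ g) ⋉ X` with `f ⋉ X ≫ g ⋉ X` and
similarly on the other side. -/
def CentralStr.comp {A A' A'' : B} {f : A ⟶ A'} {g : A' ⟶ A''} (c : CentralStr S f)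
    (d : CentralStr S g) : CentralStr S (f ≫ g) where
  lc := StrongTransOn.ofIso
    (c.lc.toStrongTrans ≫ d.lc.toStrongTrans)
    (fun X => (S.R X).mapComp f g)
  rc := StrongTransOn.ofIso
    (c.rc.toStrongTrans ≫ d.rc.toStrongTrans)
    (fun X => (S.L X).mapComp f g)

/-- A central 1-cell: a 1-cell with chosen centrality structure. -/
@[ext]
structure CentralHom (S : Binoidal B t) (A A' : B) where
  hom : A ⟶ A'
  str : CentralStr S hom

/-- A central 2-cell. -/
@[ext]
structure CentralHom₂ {A A' : B} (f g : CentralHom S A A') where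
  hom : f.hom ⟶ g.hom
  central : IsCentral₂ f.str g.str hom

namespace IsCentral₂

variable {A₀ A₁ A₂ A₃ : B}

/-- The modification between the left centrality transformations. -/
def modL {f g : A₀ ⟶ A₁} {c : CentralStr S f} {d : CentralStr S g} {σ : f ⟶ g}
    (h : IsCentral₂ c d σ) : c.lc.toStrongTrans ⟶ d.lc.toStrongTrans :=
  ⟨{ app := fun X => (S.R X).map₂ σ, naturality := h.lc }⟩

/-- The modification between the right centrality transformations. -/
def modR {f g : A₀ ⟶ A₁} {c : CentralStr S f} {d : CentralStr S g} {σ : f ⟶ g}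
    (h : IsCentral₂ c d σ) : c.rc.toStrongTrans ⟶ d.rc.toStrongTrans :=
  ⟨{ app := fun X => (S.L X).map₂ σ, naturality := h.rc }⟩

theorem of_mod {f g : A₀ ⟶ A₁} {c : CentralStr S f} {d : CentralStr S g} {σ : f ⟶ g}
    (m : c.lc.toStrongTrans ⟶ d.lc.toStrongTrans) (n : c.rc.toStrongTrans ⟶ d.rc.toStrongTrans)
    (hm : ∀ X, (S.R X).map₂ σ = m.as.app X) (hn : ∀ X, (S.L X).map₂ σ = n.as.app X) :
    IsCentral₂ c d σ where
  lc := by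
    rw [funext hm]
    exact m.as.naturality
  rc := by
    rw [funext hn]
    exact n.as.naturality

/-- The comparison of a composite centrality transformation with the vertical composite. -/
def compL {f : A₀ ⟶ A₁} {g : A₁ ⟶ A₂} (c : CentralStr S f) (d : CentralStr S g) :
    (c.comp d).lc.toStrongTrans ≅ c.lc.toStrongTrans ≫ d.lc.toStrongTrans :=
  StrongTransOn.ofIsoIso (c.lc.toStrongTrans ≫ d.lc.toStrongTrans)
    (fun X => (S.R X).mapComp f g)

/-- The comparison of a composite centrality transformation with the vertical composite. -/
def compR {f : A₀ ⟶ A₁} {g : A₁ ⟶ A₂} (c : CentralStr S f) (d : CentralStr S g) :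
    (c.comp d).rc.toStrongTrans ≅ c.rc.toStrongTrans ≫ d.rc.toStrongTrans :=
  StrongTransOn.ofIsoIso (c.rc.toStrongTrans ≫ d.rc.toStrongTrans)
    (fun X => (S.L X).mapComp f g)

/-- The comparison of the centrality transformation of `𝟙 A` with the identity. -/
def idL (S : Binoidal B t) (A : B) : (CentralStr.id S A).lc.toStrongTrans ≅ 𝟙 (S.L A) :=
  StrongTransOn.ofIsoIso (𝟙 (S.L A)) (fun X => (S.R X).mapId A)

/-- The comparison of the centrality transformation of `𝟙 A` with the identity. -/
def idR (S : Binoidal B t) (A : B) : (CentralStr.id S A).rc.toStrongTrans ≅ 𝟙 (S.R A) :=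
  StrongTransOn.ofIsoIso (𝟙 (S.R A)) (fun X => (S.L X).mapId A)

theorem id {f : A₀ ⟶ A₁} (c : CentralStr S f) : IsCentral₂ c c (𝟙 f) :=
  of_mod (𝟙 _) (𝟙 _) (fun X => (S.R X).map₂_id f) (fun X => (S.L X).map₂_id f)

theorem vcomp {f g h : A₀ ⟶ A₁} {c : CentralStr S f} {d : CentralStr S g} {e : CentralStr S h}
    {σ : f ⟶ g} {τ : g ⟶ h} (hσ : IsCentral₂ c d σ) (hτ : IsCentral₂ d e τ) :
    IsCentral₂ c e (σ ≫ τ) :=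
  of_mod (hσ.modL ≫ hτ.modL) (hσ.modR ≫ hτ.modR)
    (fun X => (S.R X).map₂_comp σ τ) (fun X => (S.L X).map₂_comp σ τ)

theorem whiskerLeft {f : A₀ ⟶ A₁} {g h : A₁ ⟶ A₂} (c : CentralStr S f) {d : CentralStr S g}
    {e : CentralStr S h} {σ : g ⟶ h} (hσ : IsCentral₂ d e σ) :
    IsCentral₂ (c.comp d) (c.comp e) (f ◁ σ) :=
  of_mod ((compL c d).hom ≫ c.lc.toStrongTrans ◁ hσ.modL ≫ (compL c e).inv)
    ((compR c d).hom ≫ c.rc.toStrongTrans ◁ hσ.modR ≫ (compR c e).inv)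
    (fun X => (S.R X).map₂_whisker_left f σ) (fun X => (S.L X).map₂_whisker_left f σ)

theorem whiskerRight {f g : A₀ ⟶ A₁} {h : A₁ ⟶ A₂} {c : CentralStr S f} {d : CentralStr S g}
    {σ : f ⟶ g} (hσ : IsCentral₂ c d σ) (e : CentralStr S h) :
    IsCentral₂ (c.comp e) (d.comp e) (σ ▷ h) :=
  of_mod ((compL c e).hom ≫ hσ.modL ▷ e.lc.toStrongTrans ≫ (compL d e).inv)
    ((compR c e).hom ≫ hσ.modR ▷ e.rc.toStrongTrans ≫ (compR d e).inv)
    (fun X => (S.R X).map₂_whisker_right σ h) (fun X => (S.L X).map₂_whisker_right σ h)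

theorem inv {f g : A₀ ⟶ A₁} {c : CentralStr S f} {d : CentralStr S g} {σ : f ≅ g}
    (hσ : IsCentral₂ c d σ.hom) : IsCentral₂ d c σ.inv where
  lc := (Pseudofunctor.StrongTrans.isoMk (η := c.lc.toStrongTrans) (θ := d.lc.toStrongTrans)
    (fun X => (S.R X).map₂Iso σ) hσ.lc).inv.as.naturality
  rc := (Pseudofunctor.StrongTrans.isoMk (η := c.rc.toStrongTrans) (θ := d.rc.toStrongTrans)
    (fun X => (S.L X).map₂Iso σ) hσ.rc).inv.as.naturality

theorem associator {f : A₀ ⟶ A₁} {g : A₁ ⟶ A₂} {h : A₂ ⟶ A₃} (c : CentralStr S f)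
    (d : CentralStr S g) (e : CentralStr S h) :
    IsCentral₂ ((c.comp d).comp e) (c.comp (d.comp e)) (α_ f g h).hom :=
  of_mod
    ((compL (c.comp d) e).hom ≫ (compL c d).hom ▷ e.lc.toStrongTrans ≫ (α_ _ _ _).hom ≫
      c.lc.toStrongTrans ◁ (compL d e).inv ≫ (compL c (d.comp e)).inv)
    ((compR (c.comp d) e).hom ≫ (compR c d).hom ▷ e.rc.toStrongTrans ≫ (α_ _ _ _).hom ≫
      c.rc.toStrongTrans ◁ (compR d e).inv ≫ (compR c (d.comp e)).inv)
    (fun X => (S.R X).map₂_associator f g h) (fun X => (S.L X).map₂_associator f g h)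

theorem leftUnitor {f : A₀ ⟶ A₁} (c : CentralStr S f) :
    IsCentral₂ ((CentralStr.id S A₀).comp c) c (λ_ f).hom :=
  of_mod
    ((compL (CentralStr.id S A₀) c).hom ≫ (idL S A₀).hom ▷ c.lc.toStrongTrans ≫ (λ_ _).hom)
    ((compR (CentralStr.id S A₀) c).hom ≫ (idR S A₀).hom ▷ c.rc.toStrongTrans ≫ (λ_ _).hom)
    (fun X => (S.R X).map₂_left_unitor f) (fun X => (S.L X).map₂_left_unitor f)

theorem rightUnitor {f : A₀ ⟶ A₁} (c : CentralStr S f) :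
    IsCentral₂ (c.comp (CentralStr.id S A₁)) c (ρ_ f).hom :=
  of_mod
    ((compL c (CentralStr.id S A₁)).hom ≫ c.lc.toStrongTrans ◁ (idL S A₁).hom ≫ (ρ_ _).hom)
    ((compR c (CentralStr.id S A₁)).hom ≫ c.rc.toStrongTrans ◁ (idR S A₁).hom ≫ (ρ_ _).hom)
    (fun X => (S.R X).map₂_right_unitor f) (fun X => (S.L X).map₂_right_unitor f)

end IsCentral₂

/-- The objects of the centre of a binoidal bicategory: the objects of the bicategory. -/
structure Centre (S : Binoidal B t) where
  obj : B

instance (S : Binoidal B t) : CategoryStruct (Centre S) where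
  Hom A A' := CentralHom S A.obj A'.obj
  id A := ⟨𝟙 A.obj, CentralStr.id S A.obj⟩
  comp f g := ⟨f.hom ≫ g.hom, f.str.comp g.str⟩

instance (A A' : Centre S) : Category (A ⟶ A') where
  Hom f g := CentralHom₂ f g
  id f := ⟨𝟙 f.hom, IsCentral₂.id f.str⟩
  comp σ τ := ⟨σ.hom ≫ τ.hom, σ.central.vcomp τ.central⟩

/-- An invertible 2-cell that is central is an invertible 2-cell of the centre. -/
def centralIso {A A' : Centre S} {f g : A ⟶ A'} (σ : f.hom ≅ g.hom)
    (h : IsCentral₂ f.str g.str σ.hom) : f ≅ g where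
  hom := ⟨σ.hom, h⟩
  inv := ⟨σ.inv, h.inv⟩
  hom_inv_id := CentralHom₂.ext σ.hom_inv_id
  inv_hom_id := CentralHom₂.ext σ.inv_hom_id

/-- The centre: central 1-cells and central 2-cells. -/
instance (S : Binoidal B t) : Bicategory (Centre S) where
  whiskerLeft f _ _ σ := CentralHom₂.mk (f.hom ◁ CentralHom₂.hom σ) ((CentralHom₂.central σ).whiskerLeft f.str)
  whiskerRight σ h := CentralHom₂.mk (CentralHom₂.hom σ ▷ h.hom) ((CentralHom₂.central σ).whiskerRight h.str)
  associator f g h := centralIso (α_ f.hom g.hom h.hom) (IsCentral₂.associator f.str g.str h.str)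
  leftUnitor f := centralIso (λ_ f.hom) (IsCentral₂.leftUnitor f.str)
  rightUnitor f := centralIso (ρ_ f.hom) (IsCentral₂.rightUnitor f.str)
  whiskerLeft_id _ _ := CentralHom₂.ext (Bicategory.whiskerLeft_id _ _)
  whiskerLeft_comp _ _ _ _ _ _ := CentralHom₂.ext (Bicategory.whiskerLeft_comp _ _ _)
  id_whiskerLeft _ := CentralHom₂.ext (Bicategory.id_whiskerLeft _)
  comp_whiskerLeft _ _ _ _ _ := CentralHom₂.ext (Bicategory.comp_whiskerLeft _ _ _)
  id_whiskerRight _ _ := CentralHom₂.ext (Bicategory.id_whiskerRight _ _)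
  comp_whiskerRight _ _ _ := CentralHom₂.ext (Bicategory.comp_whiskerRight _ _ _)
  whiskerRight_id _ := CentralHom₂.ext (Bicategory.whiskerRight_id _)
  whiskerRight_comp _ _ _ := CentralHom₂.ext (Bicategory.whiskerRight_comp _ _ _)
  whisker_assoc _ _ _ _ _ := CentralHom₂.ext (Bicategory.whisker_assoc _ _ _)
  whisker_exchange _ _ := CentralHom₂.ext (Bicategory.whisker_exchange _ _)
  pentagon _ _ _ _ := CentralHom₂.ext (Bicategory.pentagon _ _ _ _)
  triangle _ _ := CentralHom₂.ext (Bicategory.triangle _ _)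

/-- The forgetful pseudofunctor from the centre. -/
def Centre.forget (S : Binoidal B t) : Centre S ⥤ᵖ B where
  obj A := A.obj
  map f := CentralHom.hom f
  map₂ σ := CentralHom₂.hom σ
  map₂_id _ := rfl
  map₂_comp _ _ := rfl
  mapId _ := Iso.refl _
  mapComp _ _ := Iso.refl _
  map₂_whisker_left f _ _ σ :=
    ((Category.id_comp _).trans (Category.comp_id (f.hom ◁ CentralHom₂.hom σ))).symm
  map₂_whisker_right σ h :=
    ((Category.id_comp _).trans (Category.comp_id (CentralHom₂.hom σ ▷ h.hom))).symm
  map₂_associator f g h := by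
    change (α_ f.hom g.hom h.hom).hom = 𝟙 ((f.hom ≫ g.hom) ≫ h.hom) ≫ 𝟙 (f.hom ≫ g.hom) ▷ h.hom ≫
      (α_ f.hom g.hom h.hom).hom ≫ f.hom ◁ 𝟙 (g.hom ≫ h.hom) ≫ 𝟙 (f.hom ≫ g.hom ≫ h.hom)
    simp
  map₂_left_unitor {A A'} f := by
    change (λ_ f.hom).hom = 𝟙 (𝟙 A.obj ≫ f.hom) ≫ 𝟙 (𝟙 A.obj) ▷ f.hom ≫ (λ_ f.hom).hom
    simp
  map₂_right_unitor {A A'} f := by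
    change (ρ_ f.hom).hom = 𝟙 (f.hom ≫ 𝟙 A'.obj) ≫ f.hom ◁ 𝟙 (𝟙 A'.obj) ≫ (ρ_ f.hom).hom
    simp

end Centrality

section Premonoidal

variable {B : Type u} [Bicategory.{w, v} B] {t : B → B → B}

/-- An associator: adjoint equivalences `(XY)Z ⟶ X(YZ)` with central 1-cells, pseudonatural in each
argument separately. -/
structure Associator (S : Binoidal B t) where
  equiv (X Y Z : B) : Bicategory.Equivalence (t (t X Y) Z) (t X (t Y Z))
  /-- `(- ⋉ Y) ⋉ Z ⟶ - ⋉ (YZ)` -/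
  nat₁ (Y Z : B) : StrongTransOn ((S.R Y).comp (S.R Z)) (S.R (t Y Z)) (fun X => (equiv X Y Z).hom)
  /-- `(X ⋊ -) ⋉ Z ⟶ X ⋊ (- ⋉ Z)` -/
  nat₂ (X Z : B) : StrongTransOn ((S.L X).comp (S.R Z)) ((S.R Z).comp (S.L X))
    (fun Y => (equiv X Y Z).hom)
  /-- `(XY) ⋊ - ⟶ X ⋊ (Y ⋊ -)` -/
  nat₃ (X Y : B) : StrongTransOn (S.L (t X Y)) ((S.L Y).comp (S.L X)) (fun Z => (equiv X Y Z).hom)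
  central (X Y Z : B) : CentralStr S (equiv X Y Z).hom

namespace Associator

variable {S : Binoidal B t} (a : Associator S)

/-- The 1-cell `(XY)Z ⟶ X(YZ)`. -/
abbrev hom (X Y Z : B) : t (t X Y) Z ⟶ t X (t Y Z) := (a.equiv X Y Z).hom

/-- The naturality 2-cell of the associator in the first argument. -/
def cell₁ {X X' : B} (f : X ⟶ X') (Y Z : B) :
    (S.R Z).map ((S.R Y).map f) ≫ a.hom X' Y Z ≅ a.hom X Y Z ≫ (S.R (t Y Z)).map f :=
  (a.nat₁ Y Z).naturality f

/-- The naturality 2-cell of the associator in the second argument. -/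
def cell₂ (X : B) {Y Y' : B} (g : Y ⟶ Y') (Z : B) :
    (S.R Z).map ((S.L X).map g) ≫ a.hom X Y' Z ≅ a.hom X Y Z ≫ (S.L X).map ((S.R Z).map g) :=
  (a.nat₂ X Z).naturality g

/-- The naturality 2-cell of the associator in the third argument. -/
def cell₃ (X Y : B) {Z Z' : B} (h : Z ⟶ Z') :
    (S.L (t X Y)).map h ≫ a.hom X Y Z' ≅ a.hom X Y Z ≫ (S.L X).map ((S.L Y).map h) :=
  (a.nat₃ X Y).naturality h

end Associator

variable {S : Binoidal B t}

/-- The centrality structure `c'` on `X ⋊ f` is the one induced from the centrality structure `c`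
on `f` by the associator. As the associator is an equivalence, these conditions determine `c'`. -/
structure IsInducedL (a : Associator S) (X : B) {A A' : B} {f : A ⟶ A'} (c : CentralStr S f)
    (c' : CentralStr S ((S.L X).map f)) : Prop where
  /-- Pasting `lc (X ⋊ f)` with the associator in the third argument agrees with pasting
  `X ⋊ lc f` with it, up to the associator cells at `(X ⋊ f) ⋉ Y`. -/
  lc : TransData.IsModification
    (TransData.comp c'.lc.data (a.nat₃ X A').data)
    (TransData.comp (a.nat₃ X A).data (TransData.post c.lc.data (S.L X)))
    (fun Y => (a.cell₂ X f Y).hom)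
  rc : TransData.IsModification
    (TransData.comp (TransData.pre (under (S.R X)) c.rc.data) (a.nat₁ X A').data)
    (TransData.comp (a.nat₁ X A).data c'.rc.data)
    (fun Y => (a.cell₃ Y X f).hom)

/-- The centrality structure `c'` on `f ⋉ X` is the one induced from the centrality structure `c`
on `f` by the associator. As the associator is an equivalence, these conditions determine `c'`. -/
structure IsInducedR (a : Associator S) (X : B) {A A' : B} {f : A ⟶ A'} (c : CentralStr S f)
    (c' : CentralStr S ((S.R X).map f)) : Prop where
  lc : TransData.IsModification
    (TransData.comp c'.lc.data (a.nat₃ A' X).data)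
    (TransData.comp (a.nat₃ A X).data (TransData.pre (under (S.L X)) c.lc.data))
    (fun Y => (a.cell₁ f X Y).hom)
  rc : TransData.IsModification
    (TransData.comp (TransData.post c.rc.data (S.R X)) (a.nat₁ A' X).data)
    (TransData.comp (a.nat₁ A X).data c'.rc.data)
    (fun Y => (a.cell₂ Y f X).hom)

/-- A unit object with left and right unitors: pseudonatural adjoint equivalences with central
1-cell components. -/
structure Unitors (S : Binoidal B t) where
  I : B
  equivL (X : B) : Bicategory.Equivalence (t I X) X
  natL : StrongTransOn (S.L I) (Pseudofunctor.id B) (fun X => (equivL X).hom)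
  centralL (X : B) : CentralStr S (equivL X).hom
  equivR (X : B) : Bicategory.Equivalence (t X I) X
  natR : StrongTransOn (S.R I) (Pseudofunctor.id B) (fun X => (equivR X).hom)
  centralR (X : B) : CentralStr S (equivR X).hom

namespace Unitors

variable (e : Unitors S)

/-- The left unitor `λ : IX ⟶ X`. -/
abbrev l (X : B) : t e.I X ⟶ X := (e.equivL X).hom

/-- The right unitor `ρ : XI ⟶ X`. -/
abbrev r (X : B) : t X e.I ⟶ X := (e.equivR X).hom

end Unitors

/-- The structural 2-cells of a premonoidal bicategory. -/
structure Modifs (a : Associator S) (e : Unitors S) where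
  p (W X Y Z : B) :
    (S.R Z).map (a.hom W X Y) ≫ a.hom W (t X Y) Z ≫ (S.L W).map (a.hom X Y Z) ≅
      a.hom (t W X) Y Z ≫ a.hom W X (t Y Z)
  m (X Y : B) : a.hom X e.I Y ≫ (S.L X).map (e.l Y) ≅ (S.R Y).map (e.r X)
  l (X Y : B) : (S.R Y).map (e.l X) ≅ a.hom e.I X Y ≫ e.l (t X Y)
  r (X Y : B) : e.r (t X Y) ≅ a.hom X Y e.I ≫ (S.L X).map (e.r Y)

namespace Modifs

variable {a : Associator S} {e : Unitors S} (M : Modifs a e)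

/-- The 2-cell `p_{W,X,Y,Z} ⋉ V`. -/
def pR (W X Y Z V : B) :
    (S.R V).map ((S.R Z).map (a.hom W X Y)) ≫ (S.R V).map (a.hom W (t X Y) Z) ≫
        (S.R V).map ((S.L W).map (a.hom X Y Z)) ⟶
      (S.R V).map (a.hom (t W X) Y Z) ≫ (S.R V).map (a.hom W X (t Y Z)) :=
  (mapComp₃ (S.R V) _ _ _).inv ≫ (S.R V).map₂ (M.p W X Y Z).hom ≫ ((S.R V).mapComp _ _).hom

/-- The 2-cell `V ⋊ p_{W,X,Y,Z}`. -/
def pL (V W X Y Z : B) :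
    (S.L V).map ((S.R Z).map (a.hom W X Y)) ≫ (S.L V).map (a.hom W (t X Y) Z) ≫
        (S.L V).map ((S.L W).map (a.hom X Y Z)) ⟶
      (S.L V).map (a.hom (t W X) Y Z) ≫ (S.L V).map (a.hom W X (t Y Z)) :=
  (mapComp₃ (S.L V) _ _ _).inv ≫ (S.L V).map₂ (M.p W X Y Z).hom ≫ ((S.L V).mapComp _ _).hom

/-- The 2-cell `m_{X,Y} ⋉ V`. -/
def mR (X Y V : B) :
    (S.R V).map (a.hom X e.I Y) ≫ (S.R V).map ((S.L X).map (e.l Y)) ⟶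
      (S.R V).map ((S.R Y).map (e.r X)) :=
  ((S.R V).mapComp _ _).inv ≫ (S.R V).map₂ (M.m X Y).hom

/-- The 2-cell `V ⋊ m_{X,Y}`. -/
def mL (V X Y : B) :
    (S.L V).map (a.hom X e.I Y) ≫ (S.L V).map ((S.L X).map (e.l Y)) ⟶
      (S.L V).map ((S.R Y).map (e.r X)) :=
  ((S.L V).mapComp _ _).inv ≫ (S.L V).map₂ (M.m X Y).hom

/-- The 2-cell `V ⋊ l_{X,Y}`. -/
def lL (V X Y : B) :
    (S.L V).map ((S.R Y).map (e.l X)) ⟶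
      (S.L V).map (a.hom e.I X Y) ≫ (S.L V).map (e.l (t X Y)) :=
  (S.L V).map₂ (M.l X Y).hom ≫ ((S.L V).mapComp _ _).hom

/-- The 2-cell `r_{X,Y} ⋉ V`. -/
def rR (X Y V : B) :
    (S.R V).map (e.r (t X Y)) ⟶
      (S.R V).map (a.hom X Y e.I) ≫ (S.R V).map ((S.L X).map (e.r Y)) :=
  (S.R V).map₂ (M.r X Y).hom ≫ ((S.R V).mapComp _ _).hom

/-- The structural 2-cells form modifications in each argument. Where a monoidal bicategory would
use an interchange 2-cell, the centrality structure of the associator or unitor is used. -/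
structure AreModifications : Prop where
  p₁ (X Y Z : B) : TransData.IsModification
    (TransData.comp (TransData.post (a.nat₁ X Y).data (S.R Z))
      (TransData.comp (a.nat₁ (t X Y) Z).data (a.central X Y Z).rc.data))
    (TransData.comp (TransData.pre (under (S.R X)) (a.nat₁ Y Z).data) (a.nat₁ X (t Y Z)).data)
    (fun W => (M.p W X Y Z).hom)
  p₂ (W Y Z : B) : TransData.IsModification
    (TransData.comp (TransData.post (a.nat₂ W Y).data (S.R Z))
      (TransData.comp (TransData.pre (under (S.R Y)) (a.nat₂ W Z).data)
        (TransData.post (a.nat₁ Y Z).data (S.L W))))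
    (TransData.comp (TransData.pre (under (S.L W)) (a.nat₁ Y Z).data) (a.nat₂ W (t Y Z)).data)
    (fun X => (M.p W X Y Z).hom)
  p₃ (W X Z : B) : TransData.IsModification
    (TransData.comp (TransData.post (a.nat₃ W X).data (S.R Z))
      (TransData.comp (TransData.pre (under (S.L X)) (a.nat₂ W Z).data)
        (TransData.post (a.nat₂ X Z).data (S.L W))))
    (TransData.comp (a.nat₂ (t W X) Z).data (TransData.pre (under (S.R Z)) (a.nat₃ W X).data))
    (fun Y => (M.p W X Y Z).hom)
  p₄ (W X Y : B) : TransData.IsModification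
    (TransData.comp (a.central W X Y).lc.data
      (TransData.comp (a.nat₃ W (t X Y)).data (TransData.post (a.nat₃ X Y).data (S.L W))))
    (TransData.comp (a.nat₃ (t W X) Y).data (TransData.pre (under (S.L Y)) (a.nat₃ W X).data))
    (fun Z => (M.p W X Y Z).hom)
  m₁ (Y : B) : TransData.IsModification
    (TransData.comp (a.nat₁ e.I Y).data (e.centralL Y).rc.data)
    (TransData.post e.natR.data (S.R Y))
    (fun X => (M.m X Y).hom)
  m₂ (X : B) : TransData.IsModification
    (TransData.comp (a.nat₃ X e.I).data (TransData.post e.natL.data (S.L X)))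
    (e.centralR X).lc.data
    (fun Y => (M.m X Y).hom)
  l₁ (Y : B) : TransData.IsModification
    (TransData.post e.natL.data (S.R Y))
    (TransData.comp (a.nat₂ e.I Y).data (TransData.pre (under (S.R Y)) e.natL.data))
    (fun X => (M.l X Y).hom)
  l₂ (X : B) : TransData.IsModification
    (e.centralL X).lc.data
    (TransData.comp (a.nat₃ e.I X).data (TransData.pre (under (S.L X)) e.natL.data))
    (fun Y => (M.l X Y).hom)
  r₁ (Y : B) : TransData.IsModification
    (TransData.pre (under (S.R Y)) e.natR.data)
    (TransData.comp (a.nat₁ Y e.I).data (e.centralR Y).rc.data)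
    (fun X => (M.r X Y).hom)
  r₂ (X : B) : TransData.IsModification
    (TransData.pre (under (S.L X)) e.natR.data)
    (TransData.comp (a.nat₂ X e.I).data (TransData.post e.natR.data (S.L X)))
    (fun Y => (M.r X Y).hom)

/-- The structural 2-cells are central. The centrality structures of `α ⋉ Z`, `X ⋊ λ` and so on are
those induced by the associator. -/
structure AreCentral : Prop where
  p (W X Y Z : B) (c : CentralStr S ((S.R Z).map (a.hom W X Y)))
    (_ : IsInducedR a Z (a.central W X Y) c) (d : CentralStr S ((S.L W).map (a.hom X Y Z)))
    (_ : IsInducedL a W (a.central X Y Z) d) :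
    IsCentral₂ (c.comp ((a.central W (t X Y) Z).comp d))
      ((a.central (t W X) Y Z).comp (a.central W X (t Y Z))) (M.p W X Y Z).hom
  m (X Y : B) (c : CentralStr S ((S.L X).map (e.l Y))) (_ : IsInducedL a X (e.centralL Y) c)
    (d : CentralStr S ((S.R Y).map (e.r X))) (_ : IsInducedR a Y (e.centralR X) d) :
    IsCentral₂ ((a.central X e.I Y).comp c) d (M.m X Y).hom
  l (X Y : B) (c : CentralStr S ((S.R Y).map (e.l X))) (_ : IsInducedR a Y (e.centralL X) c) :
    IsCentral₂ c ((a.central e.I X Y).comp (e.centralL (t X Y))) (M.l X Y).hom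
  r (X Y : B) (c : CentralStr S ((S.L X).map (e.r Y))) (_ : IsInducedL a X (e.centralR Y) c) :
    IsCentral₂ (e.centralR (t X Y)) ((a.central X Y e.I).comp c) (M.r X Y).hom

/-- The coherence equations of a monoidal bicategory, `⊗≫` denoting composition up to the
structural isomorphisms of the bicategory. -/
structure AreCoherent : Prop where
  /-- The associahedron equation for `(((VW)X)Y)Z`. -/
  assoc (V W X Y Z : B) :
    𝟙 ((S.R Z).map ((S.R Y).map (a.hom V W X)) ≫ (S.R Z).map (a.hom V (t W X) Y) ≫
        (S.R Z).map ((S.L V).map (a.hom W X Y)) ≫ a.hom V (t W (t X Y)) Z ≫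
        (S.L V).map (a.hom W (t X Y) Z) ≫ (S.L V).map ((S.L W).map (a.hom X Y Z))) ⊗≫
      M.pR V W X Y Z ▷ (a.hom V (t W (t X Y)) Z ≫ (S.L V).map (a.hom W (t X Y) Z) ≫
        (S.L V).map ((S.L W).map (a.hom X Y Z))) ⊗≫
      (S.R Z).map (a.hom (t V W) X Y) ◁ (M.p V W (t X Y) Z).hom ▷
        (S.L V).map ((S.L W).map (a.hom X Y Z)) ⊗≫
      ((S.R Z).map (a.hom (t V W) X Y) ≫ a.hom (t V W) (t X Y) Z) ◁
        (a.cell₃ V W (a.hom X Y Z)).inv ⊗≫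
      (M.p (t V W) X Y Z).hom ▷ a.hom V W (t X (t Y Z)) ⊗≫
      𝟙 (a.hom (t (t V W) X) Y Z ≫ a.hom (t V W) X (t Y Z) ≫ a.hom V W (t X (t Y Z))) =
    𝟙 ((S.R Z).map ((S.R Y).map (a.hom V W X)) ≫ (S.R Z).map (a.hom V (t W X) Y) ≫
        (S.R Z).map ((S.L V).map (a.hom W X Y)) ≫ a.hom V (t W (t X Y)) Z ≫
        (S.L V).map (a.hom W (t X Y) Z) ≫ (S.L V).map ((S.L W).map (a.hom X Y Z))) ⊗≫
      ((S.R Z).map ((S.R Y).map (a.hom V W X)) ≫ (S.R Z).map (a.hom V (t W X) Y)) ◁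
        (a.cell₂ V (a.hom W X Y) Z).hom ▷
        ((S.L V).map (a.hom W (t X Y) Z) ≫ (S.L V).map ((S.L W).map (a.hom X Y Z))) ⊗≫
      ((S.R Z).map ((S.R Y).map (a.hom V W X)) ≫ (S.R Z).map (a.hom V (t W X) Y) ≫
        a.hom V (t (t W X) Y) Z) ◁ M.pL V W X Y Z ⊗≫
      (S.R Z).map ((S.R Y).map (a.hom V W X)) ◁ (M.p V (t W X) Y Z).hom ▷
        (S.L V).map (a.hom W X (t Y Z)) ⊗≫
      (a.cell₁ (a.hom V W X) Y Z).hom ▷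
        (a.hom V (t W X) (t Y Z) ≫ (S.L V).map (a.hom W X (t Y Z))) ⊗≫
      a.hom (t (t V W) X) Y Z ◁ (M.p V W X (t Y Z)).hom ⊗≫
      𝟙 (a.hom (t (t V W) X) Y Z ≫ a.hom (t V W) X (t Y Z) ≫ a.hom V W (t X (t Y Z)))
  /-- The unit equation for `((XI)Y)Z`. -/
  unitL (X Y Z : B) :
    𝟙 ((S.R Z).map (a.hom X e.I Y) ≫ a.hom X (t e.I Y) Z ≫
        (S.L X).map ((S.R Z).map (e.l Y))) ⊗≫
      ((S.R Z).map (a.hom X e.I Y) ≫ a.hom X (t e.I Y) Z) ◁ M.lL X Y Z ⊗≫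
      (M.p X e.I Y Z).hom ▷ (S.L X).map (e.l (t Y Z)) ⊗≫
      a.hom (t X e.I) Y Z ◁ (M.m X (t Y Z)).hom ⊗≫
      𝟙 (a.hom (t X e.I) Y Z ≫ (S.R (t Y Z)).map (e.r X)) =
    𝟙 ((S.R Z).map (a.hom X e.I Y) ≫ a.hom X (t e.I Y) Z ≫
        (S.L X).map ((S.R Z).map (e.l Y))) ⊗≫
      (S.R Z).map (a.hom X e.I Y) ◁ (a.cell₂ X (e.l Y) Z).inv ⊗≫
      M.mR X Y Z ▷ a.hom X Y Z ⊗≫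
      (a.cell₁ (e.r X) Y Z).hom ⊗≫
      𝟙 (a.hom (t X e.I) Y Z ≫ (S.R (t Y Z)).map (e.r X))
  /-- The unit equation for `((XY)I)Z`. -/
  unitR (X Y Z : B) :
    𝟙 ((S.R Z).map (a.hom X Y e.I) ≫ a.hom X (t Y e.I) Z ≫ (S.L X).map (a.hom Y e.I Z) ≫
        (S.L X).map ((S.L Y).map (e.l Z))) ⊗≫
      (M.p X Y e.I Z).hom ▷ (S.L X).map ((S.L Y).map (e.l Z)) ⊗≫
      a.hom (t X Y) e.I Z ◁ (a.cell₃ X Y (e.l Z)).inv ⊗≫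
      (M.m (t X Y) Z).hom ▷ a.hom X Y Z ⊗≫
      M.rR X Y Z ▷ a.hom X Y Z ⊗≫
      𝟙 ((S.R Z).map (a.hom X Y e.I) ≫ (S.R Z).map ((S.L X).map (e.r Y)) ≫ a.hom X Y Z) =
    𝟙 ((S.R Z).map (a.hom X Y e.I) ≫ a.hom X (t Y e.I) Z ≫ (S.L X).map (a.hom Y e.I Z) ≫
        (S.L X).map ((S.L Y).map (e.l Z))) ⊗≫
      ((S.R Z).map (a.hom X Y e.I) ≫ a.hom X (t Y e.I) Z) ◁ M.mL X Y Z ⊗≫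
      (S.R Z).map (a.hom X Y e.I) ◁ (a.cell₂ X (e.r Y) Z).inv ⊗≫
      𝟙 ((S.R Z).map (a.hom X Y e.I) ≫ (S.R Z).map ((S.L X).map (e.r Y)) ≫ a.hom X Y Z)

end Modifs

/-- A premonoidal structure on a binoidal bicategory. -/
structure Premonoidal (S : Binoidal B t) where
  assoc : Associator S
  unitors : Unitors S
  modifs : Modifs assoc unitors
  areModifications : modifs.AreModifications
  areCentral : modifs.AreCentral
  areCoherent : modifs.AreCoherent

/-- The tensor product of objects of the centre. -/
abbrev Centre.tensor (S : Binoidal B t) (X Y : Centre S) : Centre S := ⟨t X.obj Y.obj⟩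

end Premonoidal

end PremonoidalBicat

/-!
# The centre of a premonoidal bicategory is binoidal

The associator `α` has equivalences as components, and whiskering with an equivalence is fully
faithful on 2-cells. Two consequences carry the proof.

*Existence of the induced centrality structures.* The condition that `lc (X ⋊ f)` be induced from
`lc f` says that `lc (X ⋊ f)` followed by `α` is a prescribed pseudonatural transformation, namely
`α` followed by `X ⋊ lc f`, with its components replaced along the naturality 2-cells of `α` in the
argument `f`. A pseudonatural transformation whose components end in those of a pointwise
equivalence `θ` factors through `θ` (`StrongTransOn.factorRight`), and likewise on the other side
(`StrongTransOn.factorLeft`). This yields `CentralStr.inducedL` and `CentralStr.inducedR`, where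
`lc` is a factor with respect to `α` in its third argument and `rc` a factor with respect to `α` in
its first argument.

*Centrality of the action on 2-cells and of the constraints.* An induced centrality structure is a
square of pseudonatural transformations with two sides given by `α`, filled by an invertible
modification. The axioms for `α` as a pseudonatural transformation in the argument `f` (naturality
in 2-cells, units, composites) say that the 2-cells `X ⋊ σ` and the constraints of `X ⋊ (-)` are
compatible with these squares. As one of the sides given by `α` can be cancelled, a family of
2-cells on one of the remaining sides is a modification as soon as the corresponding family on the
opposite side is (`TransData.IsMod.top_of_square`, `TransData.IsMod.bottom_of_square`). On that
opposite side stands the modification known from the centrality of `σ`, of the identity or of the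
composite of central 1-cells.

The argument for `(-) ⋉ X` is the same, with the arguments of `α` permuted. Hence all the data of
`X ⋊ (-)` and `(-) ⋉ X` lift to the centre. The pseudofunctor axioms hold since a central 2-cell is
determined by its underlying 2-cell.
-/

namespace PremonoidalBicat

universe w₁ w₂ w₃ v₁ v₂ v₃ u₁ u₂ u₃

/-! ### Whiskering with an equivalence -/

section Equivalences

variable {B : Type u₁} [Bicategory.{w₁, v₁} B] {a b : B}

theorem isEquivalence_postcomp (e : Bicategory.Equivalence a b) (x : B) :
    (postcomp x e.hom).IsEquivalence :=
  (CategoryTheory.Equivalence.mk (postcomp x e.hom) (postcomp x e.inv)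
    (NatIso.ofComponents
      (fun f => (ρ_ f).symm ≪≫ whiskerLeftIso f e.unit ≪≫ (α_ f e.hom e.inv).symm)
      (fun η => by
        simp only [Functor.id_obj, postcomp, Functor.comp_obj, Functor.id_map, Iso.trans_hom,
          Iso.symm_hom, whiskerLeftIso_hom, Functor.comp_map, Category.assoc]
        rw [rightUnitor_inv_naturality_assoc, ← whisker_exchange_assoc]
        simp))
    (NatIso.ofComponents
      (fun f => α_ f e.inv e.hom ≪≫ whiskerLeftIso f e.counit ≪≫ ρ_ f)
      (fun η => by
        simp only [Functor.id_obj, postcomp, Functor.comp_obj, Functor.id_map, Iso.trans_hom,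
          whiskerLeftIso_hom, Functor.comp_map, Category.assoc]
        rw [← rightUnitor_naturality, whisker_exchange_assoc]
        simp))).isEquivalence_functor

theorem isEquivalence_precomp (e : Bicategory.Equivalence a b) (x : B) :
    (precomp x e.hom).IsEquivalence :=
  (CategoryTheory.Equivalence.mk (precomp x e.hom) (precomp x e.inv)
    (NatIso.ofComponents
      (fun f => (λ_ f).symm ≪≫ whiskerRightIso e.counit.symm f ≪≫ α_ e.inv e.hom f)
      (fun η => by
        simp only [Functor.id_obj, precomp, Functor.comp_obj, Functor.id_map, Iso.trans_hom,
          Iso.symm_hom, whiskerRightIso_hom, Functor.comp_map, Category.assoc]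
        rw [leftUnitor_inv_naturality_assoc, whisker_exchange_assoc]
        simp))
    (NatIso.ofComponents
      (fun f => (α_ e.hom e.inv f).symm ≪≫ whiskerRightIso e.unit.symm f ≪≫ λ_ f)
      (fun η => by
        simp only [Functor.id_obj, precomp, Functor.comp_obj, Functor.id_map, Iso.trans_hom,
          Iso.symm_hom, whiskerRightIso_hom, Functor.comp_map, Category.assoc]
        rw [← leftUnitor_naturality, ← whisker_exchange_assoc]
        simp))).isEquivalence_functor

theorem whiskerRight_cancel (e : Bicategory.Equivalence a b) {x : B} {f g : x ⟶ a} {σ τ : f ⟶ g}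
    (h : σ ▷ e.hom = τ ▷ e.hom) : σ = τ :=
  have := isEquivalence_postcomp e x
  (postcomp x e.hom).map_injective h

theorem whiskerLeft_cancel (e : Bicategory.Equivalence a b) {x : B} {f g : b ⟶ x} {σ τ : f ⟶ g}
    (h : e.hom ◁ σ = e.hom ◁ τ) : σ = τ :=
  have := isEquivalence_precomp e x
  (precomp x e.hom).map_injective h

/-- Whiskering with an equivalence on the right is full: the invertible 2-cell `f ≅ g` whose
whiskering is a given one. -/
noncomputable def unwhiskerRight (e : Bicategory.Equivalence a b) {x : B} {f g : x ⟶ a}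
    (σ : f ≫ e.hom ≅ g ≫ e.hom) : f ≅ g :=
  have := isEquivalence_postcomp e x
  (postcomp x e.hom).preimageIso σ

theorem unwhiskerRight_whiskerRight (e : Bicategory.Equivalence a b) {x : B} {f g : x ⟶ a}
    (σ : f ≫ e.hom ≅ g ≫ e.hom) : (unwhiskerRight e σ).hom ▷ e.hom = σ.hom :=
  have := isEquivalence_postcomp e x
  (postcomp x e.hom).map_preimage σ.hom

/-- Whiskering with an equivalence on the left is full: the invertible 2-cell `f ≅ g` whose
whiskering is a given one. -/
noncomputable def unwhiskerLeft (e : Bicategory.Equivalence a b) {x : B} {f g : b ⟶ x}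
    (σ : e.hom ≫ f ≅ e.hom ≫ g) : f ≅ g :=
  have := isEquivalence_precomp e x
  (precomp x e.hom).preimageIso σ

theorem whiskerLeft_unwhiskerLeft (e : Bicategory.Equivalence a b) {x : B} {f g : b ⟶ x}
    (σ : e.hom ≫ f ≅ e.hom ≫ g) : e.hom ◁ (unwhiskerLeft e σ).hom = σ.hom :=
  have := isEquivalence_precomp e x
  (precomp x e.hom).map_preimage σ.hom

end Equivalences

/-! ### Images of inverse structural 2-cells under a pseudofunctor -/

section MapInverse

variable {B : Type u₁} [Bicategory.{w₁, v₁} B] {C : Type u₂} [Bicategory.{w₂, v₂} C]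
  (F : B ⥤ᵖ C)

theorem _root_.CategoryTheory.Pseudofunctor.map₂_associator_inv_eq {a b c d : B} (f : a ⟶ b)
    (g : b ⟶ c) (h : c ⟶ d) :
    F.map₂ (α_ f g h).inv = (F.mapComp f (g ≫ h)).hom ≫ F.map f ◁ (F.mapComp g h).hom ≫
      (α_ _ _ _).inv ≫ (F.mapComp f g).inv ▷ F.map h ≫ (F.mapComp (f ≫ g) h).inv := by
  rw [← cancel_mono (F.map₂ (α_ f g h).hom), ← F.map₂_comp]
  simp

theorem _root_.CategoryTheory.Pseudofunctor.map₂_leftUnitor_inv_eq {a b : B} (f : a ⟶ b) :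
    F.map₂ (λ_ f).inv = (λ_ _).inv ≫ (F.mapId a).inv ▷ F.map f ≫ (F.mapComp (𝟙 a) f).inv := by
  rw [← cancel_mono (F.map₂ (λ_ f).hom), ← F.map₂_comp]
  simp

theorem _root_.CategoryTheory.Pseudofunctor.map₂_rightUnitor_inv_eq {a b : B} (f : a ⟶ b) :
    F.map₂ (ρ_ f).inv = (ρ_ _).inv ≫ F.map f ◁ (F.mapId b).inv ≫ (F.mapComp f (𝟙 b)).inv := by
  rw [← cancel_mono (F.map₂ (ρ_ f).hom), ← F.map₂_comp]
  simp

end MapInverse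

/-! ### Modifications between transformation data -/

namespace TransData

variable {B : Type u₁} [Bicategory.{w₁, v₁} B] {C : Type u₂} [Bicategory.{w₂, v₂} C]
  {D : Type u₃} [Bicategory.{w₃, v₃} D]

/-- The identity transformation. -/
def id (F : B ⥤q C) : TransData F F where
  app a := 𝟙 (F.obj a)
  nat f := ρ_ (F.map f) ≪≫ (λ_ (F.map f)).symm

variable {F G H K : B ⥤q C}

/-- The proposition `TransData.IsModification η θ Γ` as a structure. `IsModification` unfolds to a
statement with implicit binders, which would be instantiated whenever a proof is mentioned; the
wrapper keeps the data `η`, `θ`, `Γ` visible to unification. -/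
structure IsMod (η θ : TransData F G) (Γ : ∀ a, η.app a ⟶ θ.app a) : Prop where
  isModification : IsModification η θ Γ

namespace IsMod

theorem vcomp {η θ ι : TransData F G} {Γ : ∀ a, η.app a ⟶ θ.app a} {Θ : ∀ a, θ.app a ⟶ ι.app a}
    (hΓ : IsMod η θ Γ) (hΘ : IsMod θ ι Θ) :
    IsMod η ι (fun a => Γ a ≫ Θ a) := by
  refine ⟨fun {a b} f => ?_⟩
  rw [whiskerLeft_comp, Category.assoc, hΘ.1 f, ← Category.assoc, hΓ.1 f, Category.assoc,
    comp_whiskerRight]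

theorem symm {η θ : TransData F G} {Γ : ∀ a, η.app a ≅ θ.app a}
    (hΓ : IsMod η θ (fun a => (Γ a).hom)) :
    IsMod θ η (fun a => (Γ a).inv) := by
  refine ⟨fun {a b} f => ?_⟩
  rw [← cancel_epi (F.map f ◁ (Γ b).hom), ← cancel_mono ((Γ a).hom ▷ G.map f)]
  have := hΓ.1 f
  simp only [Category.assoc, ← this, whiskerLeft_hom_inv_assoc]
  simp [this]

/-- A family of 2-cells is a modification if it is one after composition with an invertible
modification. -/
theorem of_vcomp {η θ ι : TransData F G} {Γ : ∀ a, η.app a ⟶ θ.app a}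
    {Θ : ∀ a, θ.app a ≅ ι.app a} (hΘ : IsMod θ ι (fun a => (Θ a).hom))
    (h : IsMod η ι (fun a => Γ a ≫ (Θ a).hom)) : IsMod η θ Γ := by
  have : IsMod η θ (fun a => (Γ a ≫ (Θ a).hom) ≫ (Θ a).inv) := vcomp h (symm hΘ)
  refine ⟨fun {a b} f => ?_⟩
  simpa using this.1 f

theorem whiskerRight {η θ : TransData F G} {Γ : ∀ a, η.app a ⟶ θ.app a}
    (hΓ : IsMod η θ Γ) (κ : TransData G H) :
    IsMod (η.comp κ) (θ.comp κ) (fun a => Γ a ▷ κ.app a) := by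
  refine ⟨fun {a b} f => ?_⟩
  change F.map f ◁ Γ b ▷ κ.app b ≫ (α_ _ _ _).inv ≫ (θ.nat f).hom ▷ κ.app b ≫ (α_ _ _ _).hom ≫
      θ.app a ◁ (κ.nat f).hom ≫ (α_ _ _ _).inv =
    ((α_ _ _ _).inv ≫ (η.nat f).hom ▷ κ.app b ≫ (α_ _ _ _).hom ≫
      η.app a ◁ (κ.nat f).hom ≫ (α_ _ _ _).inv) ≫ (Γ a ▷ κ.app a) ▷ H.map f
  rw [associator_inv_naturality_middle_assoc, ← comp_whiskerRight_assoc, hΓ.1 f]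
  simp only [comp_whiskerRight, Category.assoc]
  rw [associator_naturality_left_assoc, ← whisker_exchange_assoc]
  simp

theorem whiskerLeft (κ : TransData F G) {η θ : TransData G H} {Γ : ∀ a, η.app a ⟶ θ.app a}
    (hΓ : IsMod η θ Γ) :
    IsMod (κ.comp η) (κ.comp θ) (fun a => κ.app a ◁ Γ a) := by
  refine ⟨fun {a b} f => ?_⟩
  change F.map f ◁ κ.app b ◁ Γ b ≫ (α_ _ _ _).inv ≫ (κ.nat f).hom ▷ θ.app b ≫ (α_ _ _ _).hom ≫
      κ.app a ◁ (θ.nat f).hom ≫ (α_ _ _ _).inv =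
    ((α_ _ _ _).inv ≫ (κ.nat f).hom ▷ η.app b ≫ (α_ _ _ _).hom ≫
      κ.app a ◁ (η.nat f).hom ≫ (α_ _ _ _).inv) ≫ (κ.app a ◁ Γ a) ▷ H.map f
  rw [associator_inv_naturality_right_assoc, whisker_exchange_assoc,
    associator_naturality_right_assoc, ← whiskerLeft_comp_assoc, hΓ.1 f]
  simp

/-- The vertical composition of transformations is associative up to the invertible modification
formed by the associators. -/
theorem associator (η : TransData F G) (θ : TransData G H) (ι : TransData H K) :
    IsMod ((η.comp θ).comp ι) (η.comp (θ.comp ι)) (fun _ => (α_ _ _ _).hom) := by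
  refine ⟨fun {a b} f => ?_⟩
  simp [TransData.comp]

theorem leftUnitor (η : TransData F G) :
    IsMod ((id F).comp η) η (fun _ => (λ_ _).hom) := by
  refine ⟨fun {a b} f => ?_⟩
  simp [TransData.comp, id]

theorem rightUnitor (η : TransData F G) :
    IsMod (η.comp (id G)) η (fun _ => (ρ_ _).hom) := by
  refine ⟨fun {a b} f => ?_⟩
  simp [TransData.comp, id]

theorem pre (N : D ⥤q B) {η θ : TransData F G} {Γ : ∀ a, η.app a ⟶ θ.app a}
    (hΓ : IsMod η θ Γ) :
    IsMod (TransData.pre N η) (TransData.pre N θ) (fun a => Γ (N.obj a)) :=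
  ⟨fun f => hΓ.1 (N.map f)⟩

theorem post {η θ : TransData F G} {Γ : ∀ a, η.app a ⟶ θ.app a}
    (hΓ : IsMod η θ Γ) (N : C ⥤ᵖ D) :
    IsMod (TransData.post η N) (TransData.post θ N) (fun a => N.map₂ (Γ a)) := by
  refine ⟨fun {a b} f => ?_⟩
  have := congrArg N.map₂ (hΓ.1 f)
  simp only [PrelaxFunctor.map₂_comp, Pseudofunctor.map₂_whisker_left,
    Pseudofunctor.map₂_whisker_right, Category.assoc] at this
  change N.map (F.map f) ◁ N.map₂ (Γ b) ≫ (N.mapComp (F.map f) (θ.app b)).inv ≫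
      N.map₂ (θ.nat f).hom ≫ (N.mapComp (θ.app a) (G.map f)).hom =
    ((N.mapComp (F.map f) (η.app b)).inv ≫ N.map₂ (η.nat f).hom ≫
      (N.mapComp (η.app a) (G.map f)).hom) ≫ N.map₂ (Γ a) ▷ N.map (G.map f)
  rw [← cancel_epi (N.mapComp (F.map f) (η.app b)).hom, reassoc_of% this]
  simp

/-- Postcomposition with a pseudofunctor preserves vertical composites up to an invertible
modification formed by its compositors. -/
theorem post_comp (η : TransData F G) (θ : TransData G H) (N : C ⥤ᵖ D) :
    IsMod (TransData.post (η.comp θ) N) ((TransData.post η N).comp (TransData.post θ N))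
      (fun a => (N.mapComp (η.app a) (θ.app a)).hom) := by
  refine ⟨fun {a b} f => ?_⟩
  change N.map (F.map f) ◁ (N.mapComp (η.app b) (θ.app b)).hom ≫ (α_ _ _ _).inv ≫
      ((N.mapComp _ _).inv ≫ N.map₂ (η.nat f).hom ≫ (N.mapComp _ _).hom) ▷ N.map (θ.app b) ≫
      (α_ _ _ _).hom ≫
      N.map (η.app a) ◁ ((N.mapComp _ _).inv ≫ N.map₂ (θ.nat f).hom ≫ (N.mapComp _ _).hom) ≫
      (α_ _ _ _).inv =
    ((N.mapComp _ _).inv ≫ N.map₂ ((α_ _ _ _).inv ≫ (η.nat f).hom ▷ θ.app b ≫ (α_ _ _ _).hom ≫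
      η.app a ◁ (θ.nat f).hom ≫ (α_ _ _ _).inv) ≫ (N.mapComp _ _).hom) ≫
      (N.mapComp _ _).hom ▷ N.map (H.map f)
  simp [Pseudofunctor.map₂_associator_inv_eq]

/-- Postcomposition with a pseudofunctor preserves the identity transformation up to an invertible
modification formed by its unitors. -/
theorem post_id (F : B ⥤q C) (N : C ⥤ᵖ D) :
    IsMod (TransData.post (id F) N) (id (F ⋙q under N))
      (fun a => (N.mapId (F.obj a)).hom) := by
  refine ⟨fun {a b} f => ?_⟩
  change N.map (F.map f) ◁ (N.mapId (F.obj b)).hom ≫ (ρ_ _).hom ≫ (λ_ _).inv =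
    ((N.mapComp _ _).inv ≫ N.map₂ ((ρ_ _).hom ≫ (λ_ _).inv) ≫ (N.mapComp _ _).hom) ≫
      (N.mapId _).hom ▷ N.map (F.map f)
  simp [Pseudofunctor.map₂_leftUnitor_inv_eq]

end IsMod

end TransData

/-! ### Composition and whiskering of pseudonatural transformations -/

namespace StrongTransOn

open scoped Pseudofunctor.StrongTrans

variable {B : Type u₁} [Bicategory.{w₁, v₁} B] {C : Type u₂} [Bicategory.{w₂, v₂} C]
  {D : Type u₃} [Bicategory.{w₃, v₃} D]

/-- Vertical composition of pseudonatural transformations. -/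
def comp {F G H : B ⥤ᵖ C} {app : ∀ a, F.obj a ⟶ G.obj a} {app' : ∀ a, G.obj a ⟶ H.obj a}
    (η : StrongTransOn F G app) (θ : StrongTransOn G H app') :
    StrongTransOn F H (fun a => app a ≫ app' a) where
  naturality f := (TransData.comp η.data θ.data).nat f
  naturality_naturality :=
    Pseudofunctor.StrongTrans.naturality_naturality (η.toStrongTrans ≫ θ.toStrongTrans)
  naturality_id := Pseudofunctor.StrongTrans.naturality_id (η.toStrongTrans ≫ θ.toStrongTrans)
  naturality_comp := Pseudofunctor.StrongTrans.naturality_comp (η.toStrongTrans ≫ θ.toStrongTrans)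

/-- Precomposition of a pseudonatural transformation with a pseudofunctor. -/
def pre (N : D ⥤ᵖ B) {F G : B ⥤ᵖ C} {app : ∀ a, F.obj a ⟶ G.obj a} (η : StrongTransOn F G app) :
    StrongTransOn (N.comp F) (N.comp G) (fun a => app (N.obj a)) where
  naturality f := η.naturality (N.map f)
  naturality_naturality σ := η.naturality_naturality (N.map₂ σ)
  naturality_id a := by
    have h := η.naturality_id (N.obj a)
    have h' := η.naturality_naturality (N.mapId a).hom
    change (η.naturality (N.map (𝟙 a))).hom ≫ app _ ◁ (G.map₂ (N.mapId a).hom ≫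
        (G.mapId (N.obj a)).hom) =
      (F.map₂ (N.mapId a).hom ≫ (F.mapId (N.obj a)).hom) ▷ app _ ≫ (λ_ _).hom ≫ (ρ_ _).inv
    rw [whiskerLeft_comp, ← reassoc_of% h', h]
    simp
  naturality_comp {a b c} f g := by
    have h := η.naturality_comp (N.map f) (N.map g)
    have h' := η.naturality_naturality (N.mapComp f g).hom
    change (η.naturality (N.map (f ≫ g))).hom ≫ app _ ◁ (G.map₂ (N.mapComp f g).hom ≫
        (G.mapComp (N.map f) (N.map g)).hom) =
      (F.map₂ (N.mapComp f g).hom ≫ (F.mapComp (N.map f) (N.map g)).hom) ▷ app (N.obj c) ≫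
        (α_ _ _ _).hom ≫ F.map (N.map f) ◁ (η.naturality (N.map g)).hom ≫
        (α_ _ _ _).inv ≫ (η.naturality (N.map f)).hom ▷ G.map (N.map g) ≫ (α_ _ _ _).hom
    rw [whiskerLeft_comp, ← reassoc_of% h', h]
    simp

/-- Postcomposition of a pseudonatural transformation with a pseudofunctor. -/
def post {F G : B ⥤ᵖ C} {app : ∀ a, F.obj a ⟶ G.obj a} (η : StrongTransOn F G app) (N : C ⥤ᵖ D) :
    StrongTransOn (F.comp N) (G.comp N) (fun a => N.map (app a)) where
  naturality f := (TransData.post η.data N).nat f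
  naturality_naturality {a b f g} σ := by
    have h := congrArg N.map₂ (η.naturality_naturality σ)
    simp only [PrelaxFunctor.map₂_comp, Pseudofunctor.map₂_whisker_left,
      Pseudofunctor.map₂_whisker_right, Category.assoc] at h
    change N.map₂ (F.map₂ σ) ▷ N.map (app b) ≫ (N.mapComp _ _).inv ≫
        N.map₂ (η.naturality g).hom ≫ (N.mapComp _ _).hom =
      ((N.mapComp _ _).inv ≫ N.map₂ (η.naturality f).hom ≫ (N.mapComp _ _).hom) ≫
        N.map (app a) ◁ N.map₂ (G.map₂ σ)
    rw [← cancel_epi (N.mapComp (F.map f) (app b)).hom, reassoc_of% h]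
    simp
  naturality_id a := by
    have h := congrArg N.map₂ (η.naturality_id a)
    simp only [PrelaxFunctor.map₂_comp, Pseudofunctor.map₂_whisker_left,
      Pseudofunctor.map₂_whisker_right, Category.assoc] at h
    change ((N.mapComp _ _).inv ≫ N.map₂ (η.naturality (𝟙 a)).hom ≫ (N.mapComp _ _).hom) ≫
        N.map (app a) ◁ (N.map₂ (G.mapId a).hom ≫ (N.mapId _).hom) =
      (N.map₂ (F.mapId a).hom ≫ (N.mapId _).hom) ▷ N.map (app a) ≫ (λ_ _).hom ≫ (ρ_ _).inv
    rw [← cancel_epi (N.mapComp (F.map (𝟙 a)) (app a)).hom]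
    have h2 := h =≫ (N.mapComp (app a) (𝟙 (G.obj a))).hom
    simp only [Category.assoc, Iso.inv_hom_id, Category.comp_id] at h2
    simp only [whiskerLeft_comp, Category.assoc, Iso.hom_inv_id_assoc]
    rw [reassoc_of% h2]
    simp [Pseudofunctor.map₂_rightUnitor_inv_eq]
  naturality_comp {a b c} f g := by
    have h := congrArg N.map₂ (η.naturality_comp f g)
    simp only [PrelaxFunctor.map₂_comp, Pseudofunctor.map₂_whisker_left,
      Pseudofunctor.map₂_whisker_right, Category.assoc] at h
    change ((N.mapComp _ _).inv ≫ N.map₂ (η.naturality (f ≫ g)).hom ≫ (N.mapComp _ _).hom) ≫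
        N.map (app a) ◁ (N.map₂ (G.mapComp f g).hom ≫ (N.mapComp _ _).hom) =
      (N.map₂ (F.mapComp f g).hom ≫ (N.mapComp _ _).hom) ▷ N.map (app c) ≫
        (α_ _ _ _).hom ≫ N.map (F.map f) ◁ ((N.mapComp _ _).inv ≫
          N.map₂ (η.naturality g).hom ≫ (N.mapComp _ _).hom) ≫
        (α_ _ _ _).inv ≫ ((N.mapComp _ _).inv ≫ N.map₂ (η.naturality f).hom ≫
          (N.mapComp _ _).hom) ▷ N.map (G.map g) ≫ (α_ _ _ _).hom
    rw [← cancel_epi (N.mapComp (F.map (f ≫ g)) (app c)).hom]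
    simp only [whiskerLeft_comp, Category.assoc, Iso.hom_inv_id_assoc]
    have h2 := h =≫ (N.mapComp (app a) (G.map f ≫ G.map g)).hom
    simp only [Category.assoc, Iso.inv_hom_id, Category.comp_id] at h2
    rw [reassoc_of% h2]
    simp [Pseudofunctor.map₂_associator_inv_eq]

end StrongTransOn

/-! ### Cancelling and factoring through a pointwise equivalence -/

namespace TransData.IsMod

variable {B : Type u₁} [Bicategory.{w₁, v₁} B] {C : Type u₂} [Bicategory.{w₂, v₂} C]
  {F G H : B ⥤q C}

/-- Whiskering with a pointwise equivalence on the right reflects modifications. -/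
theorem of_whiskerRight {η θ : TransData F G} {Γ : ∀ a, η.app a ⟶ θ.app a} (κ : TransData G H)
    (e : ∀ a, Bicategory.Equivalence (G.obj a) (H.obj a)) (he : ∀ a, (e a).hom = κ.app a)
    (h : IsMod (η.comp κ) (θ.comp κ) (fun a => Γ a ▷ κ.app a)) :
    IsMod η θ Γ := by
  refine ⟨fun {a b} f => ?_⟩
  apply whiskerRight_cancel (e b)
  rw [he]
  have := h.1 f
  change F.map f ◁ Γ b ▷ κ.app b ≫ (α_ _ _ _).inv ≫ (θ.nat f).hom ▷ κ.app b ≫ (α_ _ _ _).hom ≫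
      θ.app a ◁ (κ.nat f).hom ≫ (α_ _ _ _).inv =
    ((α_ _ _ _).inv ≫ (η.nat f).hom ▷ κ.app b ≫ (α_ _ _ _).hom ≫
      η.app a ◁ (κ.nat f).hom ≫ (α_ _ _ _).inv) ≫ (Γ a ▷ κ.app a) ▷ H.map f at this
  rw [associator_inv_naturality_middle_assoc, ← comp_whiskerRight_assoc] at this
  simp only [Category.assoc] at this
  rw [← associator_inv_naturality_left, whisker_exchange_assoc,
    ← associator_naturality_left_assoc, cancel_epi, ← comp_whiskerRight_assoc] at this
  simpa only [cancel_mono, ← Category.assoc] using this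

/-- Whiskering with a pointwise equivalence on the left reflects modifications. -/
theorem of_whiskerLeft (κ : TransData F G) (e : ∀ a, Bicategory.Equivalence (F.obj a) (G.obj a))
    (he : ∀ a, (e a).hom = κ.app a) {η θ : TransData G H} {Γ : ∀ a, η.app a ⟶ θ.app a}
    (h : IsMod (κ.comp η) (κ.comp θ) (fun a => κ.app a ◁ Γ a)) :
    IsMod η θ Γ := by
  refine ⟨fun {a b} f => ?_⟩
  apply whiskerLeft_cancel (e a)
  rw [he]
  have := h.1 f
  change F.map f ◁ κ.app b ◁ Γ b ≫ (α_ _ _ _).inv ≫ (κ.nat f).hom ▷ θ.app b ≫ (α_ _ _ _).hom ≫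
      κ.app a ◁ (θ.nat f).hom ≫ (α_ _ _ _).inv =
    ((α_ _ _ _).inv ≫ (κ.nat f).hom ▷ η.app b ≫ (α_ _ _ _).hom ≫
      κ.app a ◁ (η.nat f).hom ≫ (α_ _ _ _).inv) ≫ (κ.app a ◁ Γ a) ▷ H.map f at this
  rw [associator_inv_naturality_right_assoc, whisker_exchange_assoc,
    associator_naturality_right_assoc, ← whiskerLeft_comp_assoc] at this
  simp only [Category.assoc] at this
  rw [cancel_epi, cancel_epi, cancel_epi, ← associator_inv_naturality_middle,
    ← whiskerLeft_comp_assoc, cancel_mono] at this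
  exact this

end TransData.IsMod

namespace StrongTransOn

variable {B : Type u₁} [Bicategory.{w₁, v₁} B] {C : Type u₂} [Bicategory.{w₂, v₂} C]
  {F G H : B ⥤ᵖ C}

theorem inv_naturality {app : ∀ a, F.obj a ⟶ G.obj a} (η : StrongTransOn F G app) {a b : B}
    {f g : a ⟶ b} (σ : f ⟶ g) :
    (η.naturality f).inv ≫ F.map₂ σ ▷ app b = app a ◁ G.map₂ σ ≫ (η.naturality g).inv := by
  rw [Iso.inv_comp_eq, ← Category.assoc, Iso.eq_comp_inv, η.naturality_naturality]

/-- Let `θ : G ⟶ H` be a pseudonatural transformation whose components are equivalences `e a`, and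
`κ : F ⟶ H` one with components `app a ≫ e a`. Then `κ = factorRight θ κ ≫ θ` for a pseudonatural
transformation `F ⟶ G` with components `app`: its naturality 2-cell at `f`, whiskered with `e b`, is
`κ.naturality f` pasted with the inverse of `θ.naturality f`, and this determines it. -/
noncomputable def factorRight {e : ∀ a, Bicategory.Equivalence (G.obj a) (H.obj a)}
    {app : ∀ a, F.obj a ⟶ G.obj a} (θ : StrongTransOn G H (fun a => (e a).hom))
    (κ : StrongTransOn F H (fun a => app a ≫ (e a).hom)) : StrongTransOn F G app :=
  let N {a b : B} (f : a ⟶ b) : F.map f ≫ app b ≅ app a ≫ G.map f :=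
    unwhiskerRight (e b) (α_ _ _ _ ≪≫ κ.naturality f ≪≫ α_ _ _ _ ≪≫
      whiskerLeftIso (app a) (θ.naturality f).symm ≪≫ (α_ _ _ _).symm)
  have hN {a b : B} (f : a ⟶ b) : (N f).hom ▷ (e b).hom = (α_ _ _ _).hom ≫ (κ.naturality f).hom ≫
      (α_ _ _ _).hom ≫ app a ◁ (θ.naturality f).inv ≫ (α_ _ _ _).inv :=
    unwhiskerRight_whiskerRight _ _
  { naturality := N
    naturality_naturality {a b f g} σ := by
      apply whiskerRight_cancel (e b)
      simp only [comp_whiskerRight, whisker_assoc, hN, Category.assoc, Iso.inv_hom_id_assoc]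
      rw [associator_naturality_left_assoc, reassoc_of% κ.naturality_naturality σ,
        ← whiskerLeft_comp_assoc (app a) (θ.naturality f).inv, inv_naturality]
      simp
    naturality_id a := by
      apply whiskerRight_cancel (e a)
      have h : app a ◁ (θ.naturality (𝟙 a)).inv = app a ◁ ((e a).hom ◁ (H.mapId a).hom ≫
          (ρ_ _).hom ≫ (λ_ _).inv ≫ (G.mapId a).inv ▷ (e a).hom) :=
        congrArg (app a ◁ ·) (Pseudofunctor.StrongTrans.naturality_id_inv θ.toStrongTrans a)
      simp only [comp_whiskerRight, whisker_assoc, hN, h, Category.assoc, whiskerLeft_comp]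
      rw [← associator_naturality_right_assoc, reassoc_of% κ.naturality_id a]
      simp
    naturality_comp {a b c} f g := by
      apply whiskerRight_cancel (e c)
      have h : app a ◁ (θ.naturality (f ≫ g)).inv = app a ◁ ((e a).hom ◁ (H.mapComp f g).hom ≫
          (α_ _ _ _).inv ≫ (θ.naturality f).inv ▷ H.map g ≫ (α_ _ _ _).hom ≫
          G.map f ◁ (θ.naturality g).inv ≫ (α_ _ _ _).inv ≫
          (G.mapComp f g).inv ▷ (e c).hom) :=
        congrArg (app a ◁ ·) (Pseudofunctor.StrongTrans.naturality_comp_inv θ.toStrongTrans f g)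
      calc
        _ = (α_ _ _ _).hom ≫ (F.mapComp f g).hom ▷ (app c ≫ (e c).hom) ⊗≫
            F.map f ◁ (κ.naturality g).hom ⊗≫ (κ.naturality f).hom ▷ H.map g ⊗≫
            app a ◁ (θ.naturality f).inv ▷ H.map g ⊗≫
            app a ◁ G.map f ◁ (θ.naturality g).inv ⊗≫ 𝟙 _ := by
          simp only [comp_whiskerRight, whisker_assoc, hN, h, Category.assoc, whiskerLeft_comp]
          rw [← associator_naturality_right_assoc, reassoc_of% κ.naturality_comp f g]
          simp [bicategoricalComp]
        _ = (F.mapComp f g).hom ▷ app c ▷ (e c).hom ⊗≫ F.map f ◁ (κ.naturality g).hom ⊗≫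
            ((N f).hom ▷ (e b).hom) ▷ H.map g ⊗≫
            app a ◁ G.map f ◁ (θ.naturality g).inv ⊗≫ 𝟙 _ := by
          rw [hN]; bicategory
        -- The 2-cells `N f` and `(θ.naturality g).inv` act on disjoint factors; exchanging them
        -- turns the 2-cells at `g` into the whiskering of `N g` with `e c`.
        _ = (F.mapComp f g).hom ▷ app c ▷ (e c).hom ⊗≫ F.map f ◁ (κ.naturality g).hom ⊗≫
            ((N f).hom ▷ ((e b).hom ≫ H.map g) ≫ (app a ≫ G.map f) ◁ (θ.naturality g).inv) ⊗≫
            𝟙 _ := by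
          bicategory
        _ = (F.mapComp f g).hom ▷ app c ▷ (e c).hom ⊗≫ F.map f ◁ ((α_ _ _ _).hom ≫
              (κ.naturality g).hom ≫ (α_ _ _ _).hom ≫ app b ◁ (θ.naturality g).inv ≫
              (α_ _ _ _).inv) ⊗≫ (N f).hom ▷ G.map g ▷ (e c).hom ⊗≫ 𝟙 _ := by
          rw [← whisker_exchange]; bicategory
        _ = _ := by
          rw [← hN]; bicategory }

/-- The naturality 2-cells of `factorRight θ κ ≫ θ` are those of `κ`, so a modification out of `κ`
is one out of `factorRight θ κ ≫ θ`. -/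
theorem isMod_factorRight {e : ∀ a, Bicategory.Equivalence (G.obj a) (H.obj a)}
    {app : ∀ a, F.obj a ⟶ G.obj a} (θ : StrongTransOn G H (fun a => (e a).hom))
    (κ : StrongTransOn F H (fun a => app a ≫ (e a).hom)) {ι : TransData (under F) (under H)}
    {Γ : ∀ a, app a ≫ (e a).hom ⟶ ι.app a} (h : TransData.IsMod κ.data ι Γ) :
    TransData.IsMod (TransData.comp (factorRight θ κ).data θ.data) ι Γ := by
  refine ⟨fun {a b} f => (h.1 f).trans (congrArg (· ≫ Γ a ▷ H.map f) ?_)⟩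
  have hN : ((factorRight θ κ).naturality f).hom ▷ (e b).hom = _ :=
    unwhiskerRight_whiskerRight _ _
  change (κ.naturality f).hom = (α_ _ _ _).inv ≫
    ((factorRight θ κ).naturality f).hom ▷ (e b).hom ≫ (α_ _ _ _).hom ≫
      app a ◁ (θ.naturality f).hom ≫ (α_ _ _ _).inv
  simp [hN]

/-- Let `θ : F ⟶ G` be a pseudonatural transformation whose components are equivalences `e a`, and
`κ : F ⟶ H` one with components `e a ≫ app a`. Then `κ = θ ≫ factorLeft θ κ` for a pseudonatural
transformation `G ⟶ H` with components `app`: its naturality 2-cell at `f`, whiskered with `e a`, is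
the inverse of `θ.naturality f` pasted with `κ.naturality f`, and this determines it. -/
noncomputable def factorLeft {e : ∀ a, Bicategory.Equivalence (F.obj a) (G.obj a)}
    {app : ∀ a, G.obj a ⟶ H.obj a} (θ : StrongTransOn F G (fun a => (e a).hom))
    (κ : StrongTransOn F H (fun a => (e a).hom ≫ app a)) : StrongTransOn G H app :=
  let N {a b : B} (f : a ⟶ b) : G.map f ≫ app b ≅ app a ≫ H.map f :=
    unwhiskerLeft (e a) ((α_ _ _ _).symm ≪≫ whiskerRightIso (θ.naturality f).symm (app b) ≪≫
      α_ _ _ _ ≪≫ κ.naturality f ≪≫ α_ _ _ _)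
  have hN {a b : B} (f : a ⟶ b) : (e a).hom ◁ (N f).hom = (α_ _ _ _).inv ≫
      (θ.naturality f).inv ▷ app b ≫ (α_ _ _ _).hom ≫ (κ.naturality f).hom ≫ (α_ _ _ _).hom :=
    whiskerLeft_unwhiskerLeft _ _
  { naturality := N
    naturality_naturality {a b f g} σ := by
      apply whiskerLeft_cancel (e a)
      simp only [whiskerLeft_comp, hN, Category.assoc]
      have h : (θ.naturality f).inv ≫ F.map₂ σ ▷ (e b).hom =
        (e a).hom ◁ G.map₂ σ ≫ (θ.naturality g).inv := inv_naturality θ σ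
      rw [associator_inv_naturality_middle_assoc, ← comp_whiskerRight_assoc, ← h,
        comp_whiskerRight_assoc, associator_naturality_left_assoc,
        reassoc_of% κ.naturality_naturality σ]
      simp
    naturality_id a := by
      apply whiskerLeft_cancel (e a)
      have h : (θ.naturality (𝟙 a)).inv ▷ app a = ((e a).hom ◁ (G.mapId a).hom ≫
          (ρ_ _).hom ≫ (λ_ _).inv ≫ (F.mapId a).inv ▷ (e a).hom) ▷ app a :=
        congrArg (· ▷ app a) (Pseudofunctor.StrongTrans.naturality_id_inv θ.toStrongTrans a)
      simp only [whiskerLeft_comp, hN, h, Category.assoc, comp_whiskerRight]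
      rw [← associator_naturality_right, reassoc_of% κ.naturality_id a]
      simp
    naturality_comp {a b c} f g := by
      apply whiskerLeft_cancel (e a)
      have h : (θ.naturality (f ≫ g)).inv ▷ app c = ((e a).hom ◁ (G.mapComp f g).hom ≫
          (α_ _ _ _).inv ≫ (θ.naturality f).inv ▷ G.map g ≫ (α_ _ _ _).hom ≫
          F.map f ◁ (θ.naturality g).inv ≫ (α_ _ _ _).inv ≫
          (F.mapComp f g).inv ▷ (e c).hom) ▷ app c :=
        congrArg (· ▷ app c) (Pseudofunctor.StrongTrans.naturality_comp_inv θ.toStrongTrans f g)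
      calc
        _ = (e a).hom ◁ (G.mapComp f g).hom ▷ app c ⊗≫
            (θ.naturality f).inv ▷ G.map g ▷ app c ⊗≫
            F.map f ◁ (θ.naturality g).inv ▷ app c ⊗≫
            F.map f ◁ (κ.naturality g).hom ⊗≫ (κ.naturality f).hom ▷ H.map g ⊗≫ 𝟙 _ := by
          simp only [whiskerLeft_comp, hN, h, Category.assoc, comp_whiskerRight]
          rw [← associator_naturality_right, reassoc_of% κ.naturality_comp f g]
          simp [bicategoricalComp]
        _ = (e a).hom ◁ (G.mapComp f g).hom ▷ app c ⊗≫
            (θ.naturality f).inv ▷ G.map g ▷ app c ⊗≫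
            F.map f ◁ ((e b).hom ◁ (N g).hom) ⊗≫ (κ.naturality f).hom ▷ H.map g ⊗≫ 𝟙 _ := by
          rw [hN]; bicategory
        -- The 2-cells `(θ.naturality f).inv` and `N g` act on disjoint factors; exchanging them
        -- turns the 2-cells at `f` into the whiskering of `N f` with `e a`.
        _ = (e a).hom ◁ (G.mapComp f g).hom ▷ app c ⊗≫
            ((θ.naturality f).inv ▷ (G.map g ≫ app c) ≫ (F.map f ≫ (e b).hom) ◁ (N g).hom) ⊗≫
            (κ.naturality f).hom ▷ H.map g ⊗≫ 𝟙 _ := by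
          bicategory
        _ = (e a).hom ◁ (G.mapComp f g).hom ▷ app c ⊗≫
            (e a).hom ◁ G.map f ◁ (N g).hom ⊗≫ ((α_ _ _ _).inv ≫
              (θ.naturality f).inv ▷ app b ≫ (α_ _ _ _).hom ≫ (κ.naturality f).hom ≫
              (α_ _ _ _).hom) ▷ H.map g ⊗≫ 𝟙 _ := by
          rw [← whisker_exchange]; bicategory
        _ = _ := by
          rw [← hN]; bicategory }

/-- The naturality 2-cells of `θ ≫ factorLeft θ κ` are those of `κ`, so a modification out of `κ` is
one out of `θ ≫ factorLeft θ κ`. -/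
theorem isMod_factorLeft {e : ∀ a, Bicategory.Equivalence (F.obj a) (G.obj a)}
    {app : ∀ a, G.obj a ⟶ H.obj a} (θ : StrongTransOn F G (fun a => (e a).hom))
    (κ : StrongTransOn F H (fun a => (e a).hom ≫ app a)) {ι : TransData (under F) (under H)}
    {Γ : ∀ a, (e a).hom ≫ app a ⟶ ι.app a} (h : TransData.IsMod κ.data ι Γ) :
    TransData.IsMod (TransData.comp θ.data (factorLeft θ κ).data) ι Γ := by
  refine ⟨fun {a b} f => (h.1 f).trans (congrArg (· ≫ Γ a ▷ H.map f) ?_)⟩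
  have hN : (e a).hom ◁ ((factorLeft θ κ).naturality f).hom = _ := whiskerLeft_unwhiskerLeft _ _
  change (κ.naturality f).hom = (α_ _ _ _).inv ≫
    (θ.naturality f).hom ▷ app b ≫ (α_ _ _ _).hom ≫
      (e a).hom ◁ ((factorLeft θ κ).naturality f).hom ≫ (α_ _ _ _).inv
  simp [hN]

end StrongTransOn

/-! ### Squares of transformations -/

namespace TransData.IsMod

variable {B : Type u₁} [Bicategory.{w₁, v₁} B] {C : Type u₂} [Bicategory.{w₂, v₂} C]
  {F F' F'' G G' G'' : B ⥤q C}

/-- The identity square on a transformation. -/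
theorem squareId (κ : TransData F G) :
    TransData.IsMod ((id F).comp κ) (κ.comp (id G)) (fun _ => (λ_ _ ≪≫ (ρ_ _).symm).hom) :=
  vcomp (leftUnitor κ) (symm (η := κ.comp (id G)) (θ := κ) (Γ := fun a => ρ_ (κ.app a))
    (rightUnitor κ))

/-- The horizontal pasting of two squares of transformations. -/
theorem squareComp {η : TransData F F'} {η' : TransData F' F''} {κ : TransData F G}
    {κ' : TransData F' G'} {κ'' : TransData F'' G''} {ι : TransData G G'} {ι' : TransData G' G''}
    {Θ : ∀ a, η.app a ≫ κ'.app a ≅ κ.app a ≫ ι.app a}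
    {Θ' : ∀ a, η'.app a ≫ κ''.app a ≅ κ'.app a ≫ ι'.app a}
    (hΘ : IsMod (η.comp κ') (κ.comp ι) (fun a => (Θ a).hom))
    (hΘ' : IsMod (η'.comp κ'') (κ'.comp ι') (fun a => (Θ' a).hom)) :
    TransData.IsMod ((η.comp η').comp κ'') (κ.comp (ι.comp ι'))
      (fun a => (α_ _ _ _ ≪≫ whiskerLeftIso (η.app a) (Θ' a) ≪≫ (α_ _ _ _).symm ≪≫
        whiskerRightIso (Θ a) (ι'.app a) ≪≫ α_ _ _ _).hom) :=
  (associator η η' κ'').vcomp <| (whiskerLeft η hΘ').vcomp <|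
    (symm (η := (η.comp κ').comp ι') (θ := η.comp (κ'.comp ι'))
      (Γ := fun a => α_ (η.app a) (κ'.app a) (ι'.app a)) (associator η κ' ι')).vcomp <|
    (whiskerRight hΘ ι').vcomp <| associator κ ι ι'

variable {η θ : TransData F F'} {κ : TransData F G} {κ' : TransData F' G'} {ι ξ : TransData G G'}
  {Θ : ∀ a, η.app a ≫ κ'.app a ≅ κ.app a ≫ ι.app a}
  {Ξ : ∀ a, θ.app a ≫ κ'.app a ≅ κ.app a ≫ ξ.app a}
  {Γ : ∀ a, η.app a ⟶ θ.app a} {Λ : ∀ a, ι.app a ⟶ ξ.app a}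

/-- Consider two squares `Θ : η ≫ κ' ⟶ κ ≫ ι` and `Ξ : θ ≫ κ' ⟶ κ ≫ ξ` with the same vertical sides
`κ`, `κ'`, and 2-cells `Γ` between the top sides and `Λ` between the bottom sides that are
compatible with them. If `Λ` is a modification and the right side `κ'` is a pointwise equivalence,
then `Γ` is a modification. -/
theorem top_of_square (e : ∀ a, Bicategory.Equivalence (F'.obj a) (G'.obj a))
    (he : ∀ a, (e a).hom = κ'.app a)
    (hΘ : IsMod (η.comp κ') (κ.comp ι) (fun a => (Θ a).hom))
    (hΞ : IsMod (θ.comp κ') (κ.comp ξ) (fun a => (Ξ a).hom))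
    (hΛ : IsMod ι ξ Λ)
    (h : ∀ a, Γ a ▷ κ'.app a ≫ (Ξ a).hom = (Θ a).hom ≫ κ.app a ◁ Λ a) :
    IsMod η θ Γ := by
  refine of_whiskerRight κ' e he (of_vcomp (ι := κ.comp ξ) (Θ := Ξ) hΞ ?_)
  refine cast (congrArg (IsMod (η.comp κ') (κ.comp ξ)) (funext h).symm) ?_
  exact hΘ.vcomp (whiskerLeft κ hΛ)

/-- The counterpart of `top_of_square`: if `Γ` is a modification and the left side `κ` is a
pointwise equivalence, then `Λ` is a modification. -/
theorem bottom_of_square (e : ∀ a, Bicategory.Equivalence (F.obj a) (G.obj a))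
    (he : ∀ a, (e a).hom = κ.app a)
    (hΘ : IsMod (η.comp κ') (κ.comp ι) (fun a => (Θ a).hom))
    (hΞ : IsMod (θ.comp κ') (κ.comp ξ) (fun a => (Ξ a).hom))
    (hΓ : IsMod η θ Γ)
    (h : ∀ a, Γ a ▷ κ'.app a ≫ (Ξ a).hom = (Θ a).hom ≫ κ.app a ◁ Λ a) :
    IsMod ι ξ Λ := by
  refine of_whiskerLeft κ e he ?_
  rw [show (fun a => κ.app a ◁ Λ a) =
      fun a => (Θ a).inv ≫ Γ a ▷ κ'.app a ≫ (Ξ a).hom from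
    funext fun a => by rw [h, Iso.inv_hom_id_assoc]]
  exact (symm (η := η.comp κ') (θ := κ.comp ι) (Γ := Θ) hΘ).vcomp ((whiskerRight hΓ κ').vcomp hΞ)

end TransData.IsMod

open scoped Pseudofunctor.StrongTrans in
/-- A transformation with components replaced by isomorphic 1-cells is related to the original one
by the invertible modification formed by these isomorphisms. -/
theorem StrongTransOn.isMod_ofIso {B : Type u₁} [Bicategory.{w₁, v₁} B] {C : Type u₂}
    [Bicategory.{w₂, v₂} C] {F G : B ⥤ᵖ C} {app app' : ∀ a, F.obj a ⟶ G.obj a}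
    (η : StrongTransOn F G app') (e : ∀ a, app a ≅ app' a) :
    TransData.IsMod (StrongTransOn.ofIso η.toStrongTrans e).data η.data
      (fun a => (e a).hom) :=
  ⟨(StrongTransOn.ofIsoIso η.toStrongTrans e).hom.as.naturality⟩

/-! ### Induced centrality -/

section Centrality

open scoped Pseudofunctor.StrongTrans

variable {B : Type u} [Bicategory.{w, v} B] {t : B → B → B} {S : Binoidal B t}

namespace CentralStr

theorem isMod_idL (S : Binoidal B t) (A : B) :
    TransData.IsMod (CentralStr.id S A).lc.data (TransData.id (under (S.L A)))
      (fun Y => ((S.R Y).mapId A).hom) :=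
  ⟨(IsCentral₂.idL S A).hom.as.naturality⟩

theorem isMod_idR (S : Binoidal B t) (A : B) :
    TransData.IsMod (CentralStr.id S A).rc.data (TransData.id (under (S.R A)))
      (fun Y => ((S.L Y).mapId A).hom) :=
  ⟨(IsCentral₂.idR S A).hom.as.naturality⟩

variable {A A' A'' : B} {f : A ⟶ A'} {g : A' ⟶ A''}

theorem isMod_compL (c : CentralStr S f) (d : CentralStr S g) :
    TransData.IsMod (c.comp d).lc.data (TransData.comp c.lc.data d.lc.data)
      (fun Y => ((S.R Y).mapComp f g).hom) :=
  ⟨(IsCentral₂.compL c d).hom.as.naturality⟩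

theorem isMod_compR (c : CentralStr S f) (d : CentralStr S g) :
    TransData.IsMod (c.comp d).rc.data (TransData.comp c.rc.data d.rc.data)
      (fun Y => ((S.L Y).mapComp f g).hom) :=
  ⟨(IsCentral₂.compR c d).hom.as.naturality⟩

/-- The centrality structure on `X ⋊ f` induced from that of `f`. In the condition on `lc` the
associator comes after `lc (X ⋊ f)`, which is therefore a factor on the left of the pasted
transformation; in the condition on `rc` it comes before `rc (X ⋊ f)`. -/
noncomputable def inducedL (a : Associator S) (X : B) (c : CentralStr S f) :
    CentralStr S ((S.L X).map f) where
  lc := StrongTransOn.factorRight (a.nat₃ X A')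
    (StrongTransOn.ofIso ((a.nat₃ X A).comp (c.lc.post (S.L X))).toStrongTrans
      (fun Y => a.cell₂ X f Y))
  rc := StrongTransOn.factorLeft (a.nat₁ X A)
    (StrongTransOn.ofIso ((c.rc.pre (S.R X)).comp (a.nat₁ X A')).toStrongTrans
      (fun Y => (a.cell₃ Y X f).symm))

/-- The centrality structure on `f ⋉ X` induced from that of `f`, obtained in the same way as
`CentralStr.inducedL`. -/
noncomputable def inducedR (a : Associator S) (X : B) (c : CentralStr S f) :
    CentralStr S ((S.R X).map f) where
  lc := StrongTransOn.factorRight (a.nat₃ A' X)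
    (StrongTransOn.ofIso ((a.nat₃ A X).comp (c.lc.pre (S.L X))).toStrongTrans
      (fun Y => a.cell₁ f X Y))
  rc := StrongTransOn.factorLeft (a.nat₁ A X)
    (StrongTransOn.ofIso ((c.rc.post (S.R X)).comp (a.nat₁ A' X)).toStrongTrans
      (fun Y => (a.cell₂ Y f X).symm))

theorem isInducedL (a : Associator S) (X : B) (c : CentralStr S f) :
    IsInducedL a X c (c.inducedL a X) where
  lc := by
    have h : TransData.IsMod (TransData.comp (c.inducedL a X).lc.data (a.nat₃ X A').data)
        (TransData.comp (a.nat₃ X A).data (TransData.post c.lc.data (S.L X)))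
        (fun Y => (a.cell₂ X f Y).hom) :=
      StrongTransOn.isMod_factorRight (a.nat₃ X A') _
        (StrongTransOn.isMod_ofIso ((a.nat₃ X A).comp (c.lc.post (S.L X)))
          (fun Y => a.cell₂ X f Y))
    intro _ _ g
    exact h.isModification g
  rc := by
    have h : TransData.IsMod (TransData.comp (a.nat₁ X A).data (c.inducedL a X).rc.data)
        (TransData.comp (TransData.pre (under (S.R X)) c.rc.data) (a.nat₁ X A').data)
        (fun Y => (a.cell₃ Y X f).symm.hom) :=
      StrongTransOn.isMod_factorLeft (a.nat₁ X A) _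
        (StrongTransOn.isMod_ofIso ((c.rc.pre (S.R X)).comp (a.nat₁ X A'))
          (fun Y => (a.cell₃ Y X f).symm))
    intro _ _ g
    exact (TransData.IsMod.symm (η := TransData.comp (a.nat₁ X A).data (c.inducedL a X).rc.data)
      (θ := TransData.comp (TransData.pre (under (S.R X)) c.rc.data) (a.nat₁ X A').data)
      (Γ := fun Y => (a.cell₃ Y X f).symm) h).isModification g

theorem isInducedR (a : Associator S) (X : B) (c : CentralStr S f) :
    IsInducedR a X c (c.inducedR a X) where
  lc := by
    have h : TransData.IsMod (TransData.comp (c.inducedR a X).lc.data (a.nat₃ A' X).data)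
        (TransData.comp (a.nat₃ A X).data (TransData.pre (under (S.L X)) c.lc.data))
        (fun Y => (a.cell₁ f X Y).hom) :=
      StrongTransOn.isMod_factorRight (a.nat₃ A' X) _
        (StrongTransOn.isMod_ofIso ((a.nat₃ A X).comp (c.lc.pre (S.L X)))
          (fun Y => a.cell₁ f X Y))
    intro _ _ g
    exact h.isModification g
  rc := by
    have h : TransData.IsMod (TransData.comp (a.nat₁ A X).data (c.inducedR a X).rc.data)
        (TransData.comp (TransData.post c.rc.data (S.R X)) (a.nat₁ A' X).data)
        (fun Y => (a.cell₂ Y f X).symm.hom) :=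
      StrongTransOn.isMod_factorLeft (a.nat₁ A X) _
        (StrongTransOn.isMod_ofIso ((c.rc.post (S.R X)).comp (a.nat₁ A' X))
          (fun Y => (a.cell₂ Y f X).symm))
    intro _ _ g
    exact (TransData.IsMod.symm (η := TransData.comp (a.nat₁ A X).data (c.inducedR a X).rc.data)
      (θ := TransData.comp (TransData.post c.rc.data (S.R X)) (a.nat₁ A' X).data)
      (Γ := fun Y => (a.cell₂ Y f X).symm) h).isModification g

end CentralStr

theorem IsCentral₂.of_isMod {A A' : B} {f g : A ⟶ A'} {c : CentralStr S f} {d : CentralStr S g}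
    {σ : f ⟶ g} (hl : TransData.IsMod c.lc.data d.lc.data (fun Y => (S.R Y).map₂ σ))
    (hr : TransData.IsMod c.rc.data d.rc.data (fun Y => (S.L Y).map₂ σ)) : IsCentral₂ c d σ :=
  ⟨hl.isModification, hr.isModification⟩

theorem IsCentral₂.isMod_lc {A A' : B} {f g : A ⟶ A'} {c : CentralStr S f} {d : CentralStr S g}
    {σ : f ⟶ g} (h : IsCentral₂ c d σ) :
    TransData.IsMod c.lc.data d.lc.data (fun Y => (S.R Y).map₂ σ) :=
  ⟨h.lc⟩

theorem IsCentral₂.isMod_rc {A A' : B} {f g : A ⟶ A'} {c : CentralStr S f} {d : CentralStr S g}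
    {σ : f ⟶ g} (h : IsCentral₂ c d σ) :
    TransData.IsMod c.rc.data d.rc.data (fun Y => (S.L Y).map₂ σ) :=
  ⟨h.rc⟩

open TransData.IsMod

namespace IsInducedL

variable {a : Associator S} {X A A' A'' : B}

theorem isMod_lc {f : A ⟶ A'} {c : CentralStr S f} {c' : CentralStr S ((S.L X).map f)}
    (h : IsInducedL a X c c') :
    TransData.IsMod (TransData.comp c'.lc.data (a.nat₃ X A').data)
      (TransData.comp (a.nat₃ X A).data (TransData.post c.lc.data (S.L X)))
      (fun Y => (a.cell₂ X f Y).hom) :=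
  ⟨h.lc⟩

theorem isMod_rc {f : A ⟶ A'} {c : CentralStr S f} {c' : CentralStr S ((S.L X).map f)}
    (h : IsInducedL a X c c') :
    TransData.IsMod (TransData.comp (TransData.pre (under (S.R X)) c.rc.data) (a.nat₁ X A').data)
      (TransData.comp (a.nat₁ X A).data c'.rc.data) (fun Y => (a.cell₃ Y X f).hom) :=
  ⟨h.rc⟩

/-- The pseudofunctor `X ⋊ (-)` preserves central 2-cells. For `lc` the 2-cells `(X ⋊ σ) ⋉ Y` and
`X ⋊ (σ ⋉ Y)` are the top and bottom of a morphism of squares, by naturality of the associator in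
its second argument; for `rc` the third argument is used. -/
theorem map₂ {f g : A ⟶ A'} {c : CentralStr S f} {d : CentralStr S g}
    {c' : CentralStr S ((S.L X).map f)} {d' : CentralStr S ((S.L X).map g)}
    (hc : IsInducedL a X c c') (hd : IsInducedL a X d d') {σ : f ⟶ g} (hσ : IsCentral₂ c d σ) :
    IsCentral₂ c' d' ((S.L X).map₂ σ) :=
  .of_isMod
    (top_of_square (κ := (a.nat₃ X A).data) (κ' := (a.nat₃ X A').data)
      (η := c'.lc.data) (θ := d'.lc.data)
      (ι := TransData.post c.lc.data (S.L X)) (ξ := TransData.post d.lc.data (S.L X))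
      (Θ := fun Y => a.cell₂ X f Y) (Ξ := fun Y => a.cell₂ X g Y)
      (a.equiv X A') (fun _ => rfl) hc.isMod_lc hd.isMod_lc (hσ.isMod_lc.post (S.L X))
      (by intro Y; exact (a.nat₂ X Y).naturality_naturality σ))
    (bottom_of_square (κ := (a.nat₁ X A).data) (κ' := (a.nat₁ X A').data)
      (ι := c'.rc.data) (ξ := d'.rc.data)
      (η := TransData.pre (under (S.R X)) c.rc.data) (θ := TransData.pre (under (S.R X)) d.rc.data)
      (Θ := fun Y => a.cell₃ Y X f) (Ξ := fun Y => a.cell₃ Y X g)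
      (a.equiv · X A) (fun _ => rfl) hc.isMod_rc hd.isMod_rc (.pre (under (S.R X)) hσ.isMod_rc)
      (by intro Y; exact (a.nat₃ Y X).naturality_naturality σ))

/-- The unit constraint of `X ⋊ (-)` is central, by the unit axiom for the associator as a
pseudonatural transformation in its second argument (for `lc`) and in its third (for `rc`). -/
theorem mapId {c' : CentralStr S ((S.L X).map (𝟙 A))}
    (hc : IsInducedL a X (CentralStr.id S A) c') :
    IsCentral₂ c' (CentralStr.id S (t X A)) ((S.L X).mapId A).hom :=
  .of_isMod
    (of_vcomp (Θ := fun Y => (S.R Y).mapId (t X A)) (CentralStr.isMod_idL S _)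
      (top_of_square (κ := (a.nat₃ X A).data) (κ' := (a.nat₃ X A).data)
        (η := c'.lc.data) (θ := TransData.id _)
        (ι := TransData.post (CentralStr.id S A).lc.data (S.L X)) (ξ := TransData.id _)
        (Θ := fun Y => a.cell₂ X (𝟙 A) Y) (Ξ := fun _ => λ_ _ ≪≫ (ρ_ _).symm)
        (a.equiv X A) (fun _ => rfl) hc.isMod_lc (squareId _)
        (((CentralStr.isMod_idL S A).post (S.L X)).vcomp (post_id _ _))
        (by intro Y; exact ((a.nat₂ X Y).naturality_id A).symm)))
    (of_vcomp (Θ := fun Y => (S.L Y).mapId (t X A)) (CentralStr.isMod_idR S _)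
      (bottom_of_square (κ := (a.nat₁ X A).data) (κ' := (a.nat₁ X A).data)
        (ι := c'.rc.data) (ξ := TransData.id _)
        (η := TransData.pre (under (S.R X)) (CentralStr.id S A).rc.data) (θ := TransData.id _)
        (Θ := fun Y => a.cell₃ Y X (𝟙 A)) (Ξ := fun _ => λ_ _ ≪≫ (ρ_ _).symm)
        (a.equiv · X A) (fun _ => rfl) hc.isMod_rc (squareId _)
        (.pre (under (S.R X)) (CentralStr.isMod_idR S A))
        (by intro Y; exact ((a.nat₃ Y X).naturality_id A).symm)))

/-- The composition constraint of `X ⋊ (-)` is central, by the composition axiom for the associator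
as a pseudonatural transformation in its second argument (for `lc`) and in its third (for `rc`). -/
theorem mapComp {f : A ⟶ A'} {g : A' ⟶ A''} {c : CentralStr S f} {d : CentralStr S g}
    {c' : CentralStr S ((S.L X).map f)} {d' : CentralStr S ((S.L X).map g)}
    {e' : CentralStr S ((S.L X).map (f ≫ g))}
    (hc : IsInducedL a X c c') (hd : IsInducedL a X d d') (he : IsInducedL a X (c.comp d) e') :
    IsCentral₂ e' (c'.comp d') ((S.L X).mapComp f g).hom :=
  .of_isMod
    (of_vcomp (Θ := fun Y => (S.R Y).mapComp _ _) (CentralStr.isMod_compL _ _)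
      (top_of_square (Θ := fun Y => a.cell₂ X (f ≫ g) Y)
        (a.equiv X A'') (fun _ => rfl) he.isMod_lc (squareComp hc.isMod_lc hd.isMod_lc)
        (((CentralStr.isMod_compL c d).post (S.L X)).vcomp (post_comp _ _ _))
        (by intro Y; exact ((a.nat₂ X Y).naturality_comp f g).symm)))
    (of_vcomp (Θ := fun Y => (S.L Y).mapComp _ _) (CentralStr.isMod_compR _ _)
      (bottom_of_square (Θ := fun Y => a.cell₃ Y X (f ≫ g))
        (a.equiv · X A) (fun _ => rfl) he.isMod_rc (squareComp hc.isMod_rc hd.isMod_rc)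
        (.pre (under (S.R X)) (CentralStr.isMod_compR c d))
        (by intro Y; exact ((a.nat₃ Y X).naturality_comp f g).symm)))

end IsInducedL

namespace IsInducedR

variable {a : Associator S} {X A A' A'' : B}

theorem isMod_lc {f : A ⟶ A'} {c : CentralStr S f} {c' : CentralStr S ((S.R X).map f)}
    (h : IsInducedR a X c c') :
    TransData.IsMod (TransData.comp c'.lc.data (a.nat₃ A' X).data)
      (TransData.comp (a.nat₃ A X).data (TransData.pre (under (S.L X)) c.lc.data))
      (fun Y => (a.cell₁ f X Y).hom) :=
  ⟨h.lc⟩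

theorem isMod_rc {f : A ⟶ A'} {c : CentralStr S f} {c' : CentralStr S ((S.R X).map f)}
    (h : IsInducedR a X c c') :
    TransData.IsMod (TransData.comp (TransData.post c.rc.data (S.R X)) (a.nat₁ A' X).data)
      (TransData.comp (a.nat₁ A X).data c'.rc.data) (fun Y => (a.cell₂ Y f X).hom) :=
  ⟨h.rc⟩

/-- The pseudofunctor `(-) ⋉ X` preserves central 2-cells, by naturality of the associator in its
first argument (for `lc`) and in its second (for `rc`). -/
theorem map₂ {f g : A ⟶ A'} {c : CentralStr S f} {d : CentralStr S g}
    {c' : CentralStr S ((S.R X).map f)} {d' : CentralStr S ((S.R X).map g)}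
    (hc : IsInducedR a X c c') (hd : IsInducedR a X d d') {σ : f ⟶ g} (hσ : IsCentral₂ c d σ) :
    IsCentral₂ c' d' ((S.R X).map₂ σ) :=
  .of_isMod
    (top_of_square (κ := (a.nat₃ A X).data) (κ' := (a.nat₃ A' X).data)
      (η := c'.lc.data) (θ := d'.lc.data)
      (ι := TransData.pre (under (S.L X)) c.lc.data) (ξ := TransData.pre (under (S.L X)) d.lc.data)
      (Θ := fun Y => a.cell₁ f X Y) (Ξ := fun Y => a.cell₁ g X Y)
      (a.equiv A' X) (fun _ => rfl) hc.isMod_lc hd.isMod_lc (.pre (under (S.L X)) hσ.isMod_lc)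
      (by intro Y; exact (a.nat₁ X Y).naturality_naturality σ))
    (bottom_of_square (κ := (a.nat₁ A X).data) (κ' := (a.nat₁ A' X).data)
      (ι := c'.rc.data) (ξ := d'.rc.data)
      (η := TransData.post c.rc.data (S.R X)) (θ := TransData.post d.rc.data (S.R X))
      (Θ := fun Y => a.cell₂ Y f X) (Ξ := fun Y => a.cell₂ Y g X)
      (a.equiv · A X) (fun _ => rfl) hc.isMod_rc hd.isMod_rc (hσ.isMod_rc.post (S.R X))
      (by intro Y; exact (a.nat₂ Y X).naturality_naturality σ))

/-- The unit constraint of `(-) ⋉ X` is central, by the unit axiom for the associator in its first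
argument (for `lc`) and in its second (for `rc`). -/
theorem mapId {c' : CentralStr S ((S.R X).map (𝟙 A))}
    (hc : IsInducedR a X (CentralStr.id S A) c') :
    IsCentral₂ c' (CentralStr.id S (t A X)) ((S.R X).mapId A).hom :=
  .of_isMod
    (of_vcomp (Θ := fun Y => (S.R Y).mapId (t A X)) (CentralStr.isMod_idL S _)
      (top_of_square (κ := (a.nat₃ A X).data) (κ' := (a.nat₃ A X).data)
        (η := c'.lc.data) (θ := TransData.id _)
        (ι := TransData.pre (under (S.L X)) (CentralStr.id S A).lc.data) (ξ := TransData.id _)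
        (Θ := fun Y => a.cell₁ (𝟙 A) X Y) (Ξ := fun _ => λ_ _ ≪≫ (ρ_ _).symm)
        (a.equiv A X) (fun _ => rfl) hc.isMod_lc (squareId _)
        (.pre (under (S.L X)) (CentralStr.isMod_idL S A))
        (by intro Y; exact ((a.nat₁ X Y).naturality_id A).symm)))
    (of_vcomp (Θ := fun Y => (S.L Y).mapId (t A X)) (CentralStr.isMod_idR S _)
      (bottom_of_square (κ := (a.nat₁ A X).data) (κ' := (a.nat₁ A X).data)
        (ι := c'.rc.data) (ξ := TransData.id _)
        (η := TransData.post (CentralStr.id S A).rc.data (S.R X)) (θ := TransData.id _)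
        (Θ := fun Y => a.cell₂ Y (𝟙 A) X) (Ξ := fun _ => λ_ _ ≪≫ (ρ_ _).symm)
        (a.equiv · A X) (fun _ => rfl) hc.isMod_rc (squareId _)
        (((CentralStr.isMod_idR S A).post (S.R X)).vcomp (post_id _ _))
        (by intro Y; exact ((a.nat₂ Y X).naturality_id A).symm)))

/-- The composition constraint of `(-) ⋉ X` is central, by the composition axiom for the associator
in its first argument (for `lc`) and in its second (for `rc`). -/
theorem mapComp {f : A ⟶ A'} {g : A' ⟶ A''} {c : CentralStr S f} {d : CentralStr S g}
    {c' : CentralStr S ((S.R X).map f)} {d' : CentralStr S ((S.R X).map g)}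
    {e' : CentralStr S ((S.R X).map (f ≫ g))}
    (hc : IsInducedR a X c c') (hd : IsInducedR a X d d') (he : IsInducedR a X (c.comp d) e') :
    IsCentral₂ e' (c'.comp d') ((S.R X).mapComp f g).hom :=
  .of_isMod
    (of_vcomp (Θ := fun Y => (S.R Y).mapComp _ _) (CentralStr.isMod_compL _ _)
      (top_of_square (Θ := fun Y => a.cell₁ (f ≫ g) X Y)
        (a.equiv A'' X) (fun _ => rfl) he.isMod_lc (squareComp hc.isMod_lc hd.isMod_lc)
        (.pre (under (S.L X)) (CentralStr.isMod_compL c d))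
        (by intro Y; exact ((a.nat₁ X Y).naturality_comp f g).symm)))
    (of_vcomp (Θ := fun Y => (S.L Y).mapComp _ _) (CentralStr.isMod_compR _ _)
      (bottom_of_square (Θ := fun Y => a.cell₂ Y (f ≫ g) X)
        (a.equiv · A X) (fun _ => rfl) he.isMod_rc (squareComp hc.isMod_rc hd.isMod_rc)
        (((CentralStr.isMod_compR c d).post (S.R X)).vcomp (post_comp _ _ _))
        (by intro Y; exact ((a.nat₂ Y X).naturality_comp f g).symm)))

end IsInducedR

end Centrality

/-! ### The lift to the centre -/

/-- Equality of pseudofunctors. The hypotheses on the constraints are heterogeneous, since their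
types depend on the actions on 1-cells and objects; where the latter agree definitionally, they
reduce to equalities. -/
theorem pseudofunctor_ext {C : Type u₁} [Bicategory.{w₁, v₁} C] {D : Type u₂}
    [Bicategory.{w₂, v₂} D] {F G : C ⥤ᵖ D} (h : F.toPrelaxFunctor = G.toPrelaxFunctor)
    (hId : F.mapId ≍ G.mapId) (hComp : @F.mapComp ≍ @G.mapComp) : F = G := by
  cases F
  cases G
  cases h
  cases hId
  cases hComp
  rfl

namespace Centre

variable {B : Type u} [Bicategory.{w, v} B] {t : B → B → B} {S : Binoidal B t}

/-- The lift of `X ⋊ (-)` to the centre: a central 1-cell `f` is sent to `X ⋊ f` with the induced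
centrality structure. The axioms are those of `X ⋊ (-)`, as equality of central 2-cells is equality
of the underlying 2-cells. -/
noncomputable def left (a : Associator S) (X : Centre S) :
    PseudofunctorOn (fun Y : Centre S => Centre.tensor S X Y) where
  map f := CentralHom.mk ((S.L X.obj).map f.hom) (f.str.inducedL a X.obj)
  map₂ {_ _ f g} σ := CentralHom₂.mk ((S.L X.obj).map₂ (CentralHom₂.hom σ))
    ((f.str.isInducedL a X.obj).map₂ (g.str.isInducedL a X.obj) (CentralHom₂.central σ))
  map₂_id f := CentralHom₂.ext ((S.L X.obj).map₂_id f.hom)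
  map₂_comp σ τ := CentralHom₂.ext
    ((S.L X.obj).map₂_comp (CentralHom₂.hom σ) (CentralHom₂.hom τ))
  mapId A := centralIso ((S.L X.obj).mapId A.obj)
    (((CentralStr.id S A.obj).isInducedL a X.obj).mapId)
  mapComp f g := centralIso ((S.L X.obj).mapComp f.hom g.hom)
    ((f.str.isInducedL a X.obj).mapComp (g.str.isInducedL a X.obj)
      ((f.str.comp g.str).isInducedL a X.obj))
  map₂_whisker_left f _ _ σ := CentralHom₂.ext
    ((S.L X.obj).map₂_whisker_left f.hom (CentralHom₂.hom σ))
  map₂_whisker_right σ h := CentralHom₂.ext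
    ((S.L X.obj).map₂_whisker_right (CentralHom₂.hom σ) h.hom)
  map₂_associator f g h := CentralHom₂.ext ((S.L X.obj).map₂_associator f.hom g.hom h.hom)
  map₂_left_unitor f := CentralHom₂.ext ((S.L X.obj).map₂_left_unitor f.hom)
  map₂_right_unitor f := CentralHom₂.ext ((S.L X.obj).map₂_right_unitor f.hom)

/-- The lift of `(-) ⋉ X` to the centre: a central 1-cell `f` is sent to `f ⋉ X` with the induced
centrality structure. -/
noncomputable def right (a : Associator S) (X : Centre S) :
    PseudofunctorOn (fun Y : Centre S => Centre.tensor S Y X) where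
  map f := CentralHom.mk ((S.R X.obj).map f.hom) (f.str.inducedR a X.obj)
  map₂ {_ _ f g} σ := CentralHom₂.mk ((S.R X.obj).map₂ (CentralHom₂.hom σ))
    ((f.str.isInducedR a X.obj).map₂ (g.str.isInducedR a X.obj) (CentralHom₂.central σ))
  map₂_id f := CentralHom₂.ext ((S.R X.obj).map₂_id f.hom)
  map₂_comp σ τ := CentralHom₂.ext
    ((S.R X.obj).map₂_comp (CentralHom₂.hom σ) (CentralHom₂.hom τ))
  mapId A := centralIso ((S.R X.obj).mapId A.obj)
    (((CentralStr.id S A.obj).isInducedR a X.obj).mapId)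
  mapComp f g := centralIso ((S.R X.obj).mapComp f.hom g.hom)
    ((f.str.isInducedR a X.obj).mapComp (g.str.isInducedR a X.obj)
      ((f.str.comp g.str).isInducedR a X.obj))
  map₂_whisker_left f _ _ σ := CentralHom₂.ext
    ((S.R X.obj).map₂_whisker_left f.hom (CentralHom₂.hom σ))
  map₂_whisker_right σ h := CentralHom₂.ext
    ((S.R X.obj).map₂_whisker_right (CentralHom₂.hom σ) h.hom)
  map₂_associator f g h := CentralHom₂.ext ((S.R X.obj).map₂_associator f.hom g.hom h.hom)
  map₂_left_unitor f := CentralHom₂.ext ((S.R X.obj).map₂_left_unitor f.hom)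
  map₂_right_unitor f := CentralHom₂.ext ((S.R X.obj).map₂_right_unitor f.hom)

/-- The binoidal structure of the centre. -/
noncomputable def binoidal (a : Associator S) : Binoidal (Centre S) (Centre.tensor S) where
  left := left a
  right := right a

/-- The lift of `X ⋊ (-)` agrees with `X ⋊ (-)` along the forgetful pseudofunctor. The 1-cells and
2-cells agree definitionally; the constraints of the two composites differ by identity 2-cells. -/
theorem left_comp_forget (a : Associator S) (X : Centre S) :
    ((binoidal a).L X).comp (forget S) = (forget S).comp (S.L X.obj) := by
  refine pseudofunctor_ext rfl (heq_of_eq (funext fun A => Iso.ext ?_)) (heq_of_eq ?_)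
  · change ((S.L X.obj).mapId A.obj).hom ≫ 𝟙 (𝟙 (t X.obj A.obj)) =
      (S.L X.obj).map₂ (𝟙 (𝟙 A.obj)) ≫ ((S.L X.obj).mapId A.obj).hom
    rw [PrelaxFunctor.map₂_id, Category.id_comp, Category.comp_id]
  · funext A A' A'' f g
    apply Iso.ext
    change ((S.L X.obj).mapComp f.hom g.hom).hom ≫
        𝟙 ((S.L X.obj).map f.hom ≫ (S.L X.obj).map g.hom) =
      (S.L X.obj).map₂ (𝟙 (f.hom ≫ g.hom)) ≫ ((S.L X.obj).mapComp f.hom g.hom).hom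
    rw [PrelaxFunctor.map₂_id, Category.id_comp, Category.comp_id]

theorem right_comp_forget (a : Associator S) (X : Centre S) :
    ((binoidal a).R X).comp (forget S) = (forget S).comp (S.R X.obj) := by
  refine pseudofunctor_ext rfl (heq_of_eq (funext fun A => Iso.ext ?_)) (heq_of_eq ?_)
  · change ((S.R X.obj).mapId A.obj).hom ≫ 𝟙 (𝟙 (t A.obj X.obj)) =
      (S.R X.obj).map₂ (𝟙 (𝟙 A.obj)) ≫ ((S.R X.obj).mapId A.obj).hom
    rw [PrelaxFunctor.map₂_id, Category.id_comp, Category.comp_id]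
  · funext A A' A'' f g
    apply Iso.ext
    change ((S.R X.obj).mapComp f.hom g.hom).hom ≫
        𝟙 ((S.R X.obj).map f.hom ≫ (S.R X.obj).map g.hom) =
      (S.R X.obj).map₂ (𝟙 (f.hom ≫ g.hom)) ≫ ((S.R X.obj).mapComp f.hom g.hom).hom
    rw [PrelaxFunctor.map₂_id, Category.id_comp, Category.comp_id]

end Centre

end PremonoidalBicat

theorem mainTheorem5 {B : Type u} [Bicategory.{w, v} B] {t : B → B → B}
    (S : PremonoidalBicat.Binoidal B t) (P : PremonoidalBicat.Premonoidal S) :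
    ∃ Z : PremonoidalBicat.Binoidal (PremonoidalBicat.Centre S) (PremonoidalBicat.Centre.tensor S),
      (∀ X : PremonoidalBicat.Centre S,
        (Z.L X).comp (PremonoidalBicat.Centre.forget S) =
          (PremonoidalBicat.Centre.forget S).comp (S.L X.obj)) ∧
      (∀ X : PremonoidalBicat.Centre S,
        (Z.R X).comp (PremonoidalBicat.Centre.forget S) =
          (PremonoidalBicat.Centre.forget S).comp (S.R X.obj)) ∧
      (∀ (X : PremonoidalBicat.Centre S) {A A' : PremonoidalBicat.Centre S} (f : A ⟶ A'),
        ∃ c : PremonoidalBicat.CentralStr S ((S.L X.obj).map f.hom),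
          PremonoidalBicat.IsInducedL P.assoc X.obj f.str c ∧
            (Z.L X).map f = PremonoidalBicat.CentralHom.mk ((S.L X.obj).map f.hom) c) ∧
      (∀ (X : PremonoidalBicat.Centre S) {A A' : PremonoidalBicat.Centre S} (f : A ⟶ A'),
        ∃ c : PremonoidalBicat.CentralStr S ((S.R X.obj).map f.hom),
          PremonoidalBicat.IsInducedR P.assoc X.obj f.str c ∧
            (Z.R X).map f = PremonoidalBicat.CentralHom.mk ((S.R X.obj).map f.hom) c) :=
  ⟨PremonoidalBicat.Centre.binoidal P.assoc,
    PremonoidalBicat.Centre.left_comp_forget P.assoc,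
    PremonoidalBicat.Centre.right_comp_forget P.assoc,
    fun X _ _ f => ⟨_, f.str.isInducedL P.assoc X.obj, rfl⟩,
    fun X _ _ f => ⟨_, f.str.isInducedR P.assoc X.obj, rfl⟩⟩
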